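/- Let $\lambda,\mu>0$ and $d\ge 1/\lambda$. Consider the D/M/1/1 system: packets arrive at the times $\varphi+n/\lambda$, $n=0,1,2,\dots$, where the time $\varphi\ge 0$ of the first arrival is a constant or a random variable; a packet that finds the server idle is served at once, and a packet that finds it busy is discarded; the service times $X_0,X_1,\dots$ of the served packets are i.i.d. exponential with mean $1/\mu$ and independent of $\varphi$; the server is initially idle. Let $T_A(k)$ and $T_D(k)=T_A(k)+X_k$ be the arrival and departure times of the $k$-th served packet, $k\ge 0$, and let $$\Delta(t)=t-\max\{T_A(k): T_D(k)\le t\},\qquad t\ge 0,$$ be the age of information (before the first departure, $\Delta(t)=t+a_0$ with an initial age $a_0\ge 0$). For $k\ge 1$ let $g(k)$ be the length of time in $[T_D(k-1),T_D(k))$ during which $\Delta>d$, and let $\nu=1/\mathbb E[T_D(k)-T_D(k-1)]$ be the departure rate. Then, for every $k\ge 1$, $T_D(k)-T_D(k-1)$ and $g(k)$ are integrable, $\nu=\lambda(1-e^{-\mu/\lambda})$, and $$\mathbb E[g(k)]=\frac{e^{-\mu\lceil\lambda d\rceil/\lambda}}{\lambda(1-e^{-\mu/\lambda})}+e^{-\mu\lfloor\lambda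 d\rfloor/\lambda}\left[\frac{\lceil\lambda d\rceil}{\lambda}-d+\frac1\mu\right]+\frac{e^{-\mu d}}{\mu}\Big((e^{\mu/\lambda}-1)\lfloor\lambda d\rfloor-1\Big),$$ and the age violation probability is $\nu\,\mathbb E[g(k)]$, in the following sense: 1. almost surely, the fraction of time in $[0,T]$ during which $\Delta>d$ converges to $\nu\,\mathbb E[g(k)]$ as $T\to\infty$; 2. if the limit $\lim_{t\to\infty}\mathbb P(\Delta(t)>d)$ exists, it equals $\nu\,\mathbb E[g(k)]$; 3. if $\varphi$ is uniformly distributed on $[0,1/\lambda)$ (arrivals in steady state), this limit exists, so that $\lim_{t\to\infty}\mathbb P(\Delta(t)>d)=\nu\,\mathbb E[g(k)]$. -/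

import Mathlib

open MeasureTheory ProbabilityTheory Filter Topology

/- Sample paths of a single-server system without waiting room (GI/GI/1/1), arriving packets being
discarded while the server is busy. `τ n` is the time of the `n`-th arrival (`n = 0, 1, 2, …`) and
`x k` is the service time of the `k`-th served packet (`k = 0, 1, 2, …`). The server is initially
idle, so the first arriving packet is served. -/

/-- The index, among all arrivals, of the `k`-th served packet: after packet `k` has been taken into
service, the next packet served is the first later arrival that finds the server idle. -/
noncomputable def servedIndex (τ x : ℕ → ℝ) : ℕ → ℕ
  | 0 => 0
  | k + 1 => sInf {n : ℕ | servedIndex τ x k < n ∧ τ (servedIndex τ x k) + x k ≤ τ n}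

/-- `T_A(k)`: the arrival time of the `k`-th served packet. -/
noncomputable def arrivalTime (τ x : ℕ → ℝ) (k : ℕ) : ℝ := τ (servedIndex τ x k)

/-- `T_D(k)`: the departure time of the `k`-th served packet, whose service starts on arrival. -/
noncomputable def departureTime (τ x : ℕ → ℝ) (k : ℕ) : ℝ := arrivalTime τ x k + x k

/-- The age of information at time `t`: the time elapsed since the arrival (generation) of the
freshest packet that has departed by time `t`. The receiver starts with a status generated at
time `-a₀`, that is, with age `a₀` at time `0`. -/
noncomputable def ageOfInformation (τ x : ℕ → ℝ) (a₀ t : ℝ) : ℝ :=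
  t - sSup (insert (-a₀) {s : ℝ | ∃ k : ℕ, departureTime τ x k ≤ t ∧ s = arrivalTime τ x k})

/-- The time for which the age exceeds `d` between the consecutive age peaks at the departures of
the `k`-th and the `(k+1)`-st served packet. -/
noncomputable def violationDuration (τ x : ℕ → ℝ) (a₀ d : ℝ) (k : ℕ) : ℝ :=
  volume.real {t : ℝ | t ∈ Set.Ico (departureTime τ x k) (departureTime τ x (k + 1)) ∧
    d < ageOfInformation τ x a₀ t}

/-- Deterministic arrivals: one packet every `1 / lam` units of time, the first one at time `s`. -/
noncomputable def periodicArrivals (lam s : ℝ) (n : ℕ) : ℝ := s + n / lam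

/-- `ν = λ (1 - e^{-μ/λ})`. -/
noncomputable def nuDM11 (lam mu : ℝ) : ℝ := lam * (1 - Real.exp (-mu / lam))

/-- The closed form of the mean time for which the age exceeds `d` between consecutive peaks. -/
noncomputable def meanDurationDM11 (lam mu d : ℝ) : ℝ :=
  Real.exp (-mu * (⌈lam * d⌉ / lam)) / (lam * (1 - Real.exp (-mu / lam)))
    + Real.exp (-mu * (⌊lam * d⌋ / lam)) * (⌈lam * d⌉ / lam - d + 1 / mu)
    + Real.exp (-mu * d) / mu * ((Real.exp (mu / lam) - 1) * ⌊lam * d⌋ - 1)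

/-! A service of length `x` started at an arrival blocks the server until the next served arrival,
`⌈λx⌉` periods later. So the interdeparture time and the violation time are functions of the two
consecutive service times alone (`departureTime_succ_sub`, `violationDuration_eq`); phase and
history drop out.

Means: `⌈λX⌉` is geometric with success probability `p = 1 - e^{-μ/λ}`, so a cycle has mean `1/(λp)
= 1/ν`. For the violation time, condition on the first service time and cut its range at `⌊λd⌋/λ`
and `d`; memorylessness evaluates each piece (`integral_cycleViolation`).

Time average: renewal-reward. Consecutive cycles share a service time, so the strong law is applied
separately to the pairs starting at even and at odd indices.

Limit in probability: `Δ(t) ≤ d` means that some served packet is the last to have departed and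
arrived within `[t-d, t]`. By independence its probability is a convolution of the expected number
of served packets at each arrival slot with the probability of staying fresh. Geometric increments
make that expected number exactly `p` at every slot but the first
(`tsum_measure_partialSum_eq_of_geometric`). Along `t = s + j/λ` the probability tends to a sum over
translates of the fresh probability. If there is a limit in `t`, this sum is constant in `s`, and
averaging over one period turns it into an integral, which Tonelli identifies as mean cycle minus
mean violation (`lintegral_freshProb`). A uniform phase performs the same averaging for each large
`t`. -/

/-- The number of arrival periods from the start of a service of length `x` to the start of the
next one. -/
noncomputable def occupiedSlots (lam x : ℝ) : ℕ := ⌈lam * x⌉₊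

/-- The time between two consecutive departures in terms of the two service times. -/
noncomputable def cycleLength (lam : ℝ) (z : ℝ × ℝ) : ℝ := occupiedSlots lam z.1 / lam + z.2 - z.1

/-- The time for which the age exceeds `d` between two consecutive departures, in terms of the two
service times. -/
noncomputable def cycleViolation (lam d : ℝ) (z : ℝ × ℝ) : ℝ :=
  max 0 (occupiedSlots lam z.1 / lam + z.2 - max z.1 d)

/-! ### Deterministic sample-path analysis. -/

section Path

variable {lam s : ℝ} {x : ℕ → ℝ}

theorem occupiedSlots_pos (hlam : 0 < lam) {y : ℝ} (hy : 0 < y) : 0 < occupiedSlots lam y :=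
  Nat.ceil_pos.2 (mul_pos hlam hy)

theorem le_occupiedSlots_div (hlam : 0 < lam) (y : ℝ) : y ≤ occupiedSlots lam y / lam := by
  rw [le_div_iff₀ hlam, mul_comm]
  exact Nat.le_ceil _

/-- The arrivals no earlier than the end of service are those at least `⌈λx⌉` periods after its
start, wherever that start lies. Positivity of the service time makes this number at least one, so
the strict inequality in `servedIndex` holds automatically; an arrival exactly at a departure is
served. -/
theorem servedIndex_succ_periodicArrivals (hlam : 0 < lam) (hx : ∀ k, 0 < x k) (k : ℕ) :
    servedIndex (periodicArrivals lam s) x (k + 1)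
      = servedIndex (periodicArrivals lam s) x k + occupiedSlots lam (x k) := by
  have hset : {n : ℕ | servedIndex (periodicArrivals lam s) x k < n ∧
      periodicArrivals lam s (servedIndex (periodicArrivals lam s) x k) + x k
        ≤ periodicArrivals lam s n}
      = Set.Ici (servedIndex (periodicArrivals lam s) x k + occupiedSlots lam (x k)) := by
    set N := servedIndex (periodicArrivals lam s) x k
    ext n
    simp only [Set.mem_ofPred_eq, Set.mem_Ici, periodicArrivals]
    have hM := occupiedSlots_pos hlam (hx k)
    constructor
    · rintro ⟨h1, h2⟩
      obtain ⟨m, rfl⟩ := Nat.exists_eq_add_of_lt h1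
      have h3 : occupiedSlots lam (x k) ≤ m + 1 := by
        refine Nat.ceil_le.2 ?_
        have : x k ≤ ((m + 1 : ℕ) : ℝ) / lam := by
          push_cast at h2 ⊢
          have e : ((N : ℝ) + m + 1) / lam = N / lam + (m + 1) / lam := by ring
          linarith
        rw [le_div_iff₀ hlam] at this
        linarith
      omega
    · intro h
      refine ⟨by omega, ?_⟩
      have h1 : ((N : ℝ) + occupiedSlots lam (x k)) / lam ≤ n / lam := by
        gcongr
        exact_mod_cast h
      have h2 := le_occupiedSlots_div hlam (x k)
      rw [add_div] at h1
      linarith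
  rw [servedIndex, hset, csInf_Ici]

theorem servedIndex_periodicArrivals (hlam : 0 < lam) (hx : ∀ k, 0 < x k) (k : ℕ) :
    servedIndex (periodicArrivals lam s) x k = ∑ j ∈ Finset.range k, occupiedSlots lam (x j) := by
  induction k with
  | zero => simp [servedIndex]
  | succ k ih => rw [servedIndex_succ_periodicArrivals hlam hx, ih, Finset.sum_range_succ]

theorem arrivalTime_succ (hlam : 0 < lam) (hx : ∀ k, 0 < x k) (k : ℕ) :
    arrivalTime (periodicArrivals lam s) x (k + 1)
      = arrivalTime (periodicArrivals lam s) x k + occupiedSlots lam (x k) / lam := by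
  simp only [arrivalTime, servedIndex_succ_periodicArrivals hlam hx, periodicArrivals]
  push_cast
  ring

theorem departureTime_le_arrivalTime_succ (hlam : 0 < lam) (hx : ∀ k, 0 < x k) (k : ℕ) :
    departureTime (periodicArrivals lam s) x k
      ≤ arrivalTime (periodicArrivals lam s) x (k + 1) := by
  rw [arrivalTime_succ hlam hx, departureTime]
  linarith [le_occupiedSlots_div hlam (x k)]

theorem arrivalTime_lt_departureTime (hx : ∀ k, 0 < x k) (τ : ℕ → ℝ) (k : ℕ) :
    arrivalTime τ x k < departureTime τ x k := by
  rw [departureTime]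
  linarith [hx k]

theorem strictMono_departureTime (hlam : 0 < lam) (hx : ∀ k, 0 < x k) :
    StrictMono (departureTime (periodicArrivals lam s) x) :=
  strictMono_nat_of_lt_succ fun k => (departureTime_le_arrivalTime_succ hlam hx k).trans_lt
    (arrivalTime_lt_departureTime hx _ _)

theorem strictMono_arrivalTime (hlam : 0 < lam) (hx : ∀ k, 0 < x k) :
    StrictMono (arrivalTime (periodicArrivals lam s) x) :=
  strictMono_nat_of_lt_succ fun k => (arrivalTime_lt_departureTime hx _ _).trans_le
    (departureTime_le_arrivalTime_succ hlam hx k)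

theorem add_div_le_arrivalTime (hlam : 0 < lam) (hx : ∀ k, 0 < x k) (k : ℕ) :
    s + k / lam ≤ arrivalTime (periodicArrivals lam s) x k := by
  induction k with
  | zero => simp [arrivalTime, servedIndex, periodicArrivals]
  | succ k ih =>
    rw [arrivalTime_succ hlam hx]
    have : (1 : ℝ) / lam ≤ occupiedSlots lam (x k) / lam := by
      gcongr
      exact_mod_cast occupiedSlots_pos hlam (hx k)
    push_cast
    rw [add_div]
    linarith

theorem tendsto_departureTime (hlam : 0 < lam) (hx : ∀ k, 0 < x k) :
    Tendsto (departureTime (periodicArrivals lam s) x) atTop atTop := by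
  refine tendsto_atTop_mono (fun k => (add_div_le_arrivalTime hlam hx k).trans
    (arrivalTime_lt_departureTime hx _ k).le) ?_
  exact tendsto_atTop_add_const_left _ _ (tendsto_natCast_atTop_atTop.atTop_div_const hlam)

theorem departureTime_succ_sub (hlam : 0 < lam) (hx : ∀ k, 0 < x k) (k : ℕ) :
    departureTime (periodicArrivals lam s) x (k + 1) - departureTime (periodicArrivals lam s) x k
      = cycleLength lam (x k, x (k + 1)) := by
  simp only [departureTime, arrivalTime_succ hlam hx, cycleLength]
  ring

/-- A time after the first departure lies between two consecutive departures. -/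
theorem exists_mem_Ico_of_tendsto {T : ℕ → ℝ} (hT : Tendsto T atTop atTop) {t : ℝ}
    (ht : T 0 ≤ t) : ∃ k, T k ≤ t ∧ t < T (k + 1) := by
  by_contra! h
  have : ∀ k, T k ≤ t := fun k => by
    induction k with
    | zero => exact ht
    | succ k ih => exact h k ih
  obtain ⟨k, hk⟩ := (hT.eventually_gt_atTop t).exists
  exact absurd (this k) (not_le.2 hk)

variable {a₀ d t : ℝ}

theorem arrivalTime_nonneg (hlam : 0 < lam) (hx : ∀ k, 0 < x k) (hs : 0 ≤ s) (k : ℕ) :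
    0 ≤ arrivalTime (periodicArrivals lam s) x k :=
  le_trans (by positivity) (add_div_le_arrivalTime hlam hx k)

theorem ageOfInformation_of_mem_Ico (hlam : 0 < lam) (hx : ∀ k, 0 < x k) (hs : 0 ≤ s)
    (ha : 0 ≤ a₀) {k : ℕ} (h1 : departureTime (periodicArrivals lam s) x k ≤ t)
    (h2 : t < departureTime (periodicArrivals lam s) x (k + 1)) :
    ageOfInformation (periodicArrivals lam s) x a₀ t
      = t - arrivalTime (periodicArrivals lam s) x k := by
  rw [ageOfInformation]
  congr 1
  refine IsGreatest.csSup_eq ⟨Or.inr ⟨k, h1, rfl⟩, ?_⟩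
  rintro _ (rfl | ⟨j, hj, rfl⟩)
  · linarith [arrivalTime_nonneg hlam hx hs k]
  · have : j < k + 1 := (strictMono_departureTime hlam hx).lt_iff_lt.1 (hj.trans_lt h2)
    exact (strictMono_arrivalTime hlam hx).monotone (by omega)

theorem ageOfInformation_of_lt (hlam : 0 < lam) (hx : ∀ k, 0 < x k)
    (h : t < departureTime (periodicArrivals lam s) x 0) :
    ageOfInformation (periodicArrivals lam s) x a₀ t = t + a₀ := by
  have : {r : ℝ | ∃ k : ℕ, departureTime (periodicArrivals lam s) x k ≤ t ∧
      r = arrivalTime (periodicArrivals lam s) x k} = ∅ := by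
    ext r
    simp only [Set.mem_ofPred_eq, Set.mem_empty_iff_false, iff_false, not_exists, not_and]
    intro k hk
    exact absurd (h.trans_le ((strictMono_departureTime hlam hx).monotone k.zero_le))
      (not_lt.2 hk)
  rw [ageOfInformation, this]
  simp

/-- After time `d`, the age is at most `d` iff the last departed packet has been served and
arrived during the last `d` units of time. -/
theorem ageOfInformation_le_iff (hlam : 0 < lam) (hx : ∀ k, 0 < x k) (hs : 0 ≤ s)
    (ha : 0 ≤ a₀) (ht : d < t) :
    ageOfInformation (periodicArrivals lam s) x a₀ t ≤ d ↔
      ∃ k, (departureTime (periodicArrivals lam s) x k ≤ t ∧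
        t < departureTime (periodicArrivals lam s) x (k + 1)) ∧
        t - arrivalTime (periodicArrivals lam s) x k ≤ d := by
  constructor
  · intro h
    -- Before the first departure the age is `t + a₀ > d`, so only times after it matter.
    rcases lt_or_ge t (departureTime (periodicArrivals lam s) x 0) with h0 | h0
    · rw [ageOfInformation_of_lt hlam hx h0] at h
      linarith
    · obtain ⟨k, hk⟩ := exists_mem_Ico_of_tendsto (tendsto_departureTime hlam hx) h0
      rw [ageOfInformation_of_mem_Ico hlam hx hs ha hk.1 hk.2] at h
      exact ⟨k, hk, h⟩
  · rintro ⟨k, hk, h⟩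
    rwa [ageOfInformation_of_mem_Ico hlam hx hs ha hk.1 hk.2]

/-- Within the cycle the age is `t - A`, so the violation set is, up to endpoints, the interval from
`max (A + x k) (A + d)` to the next departure. The arrival time `A` cancels from its length. -/
theorem violationDuration_eq (hlam : 0 < lam) (hx : ∀ k, 0 < x k) (hs : 0 ≤ s)
    (ha : 0 ≤ a₀) (k : ℕ) :
    violationDuration (periodicArrivals lam s) x a₀ d k
      = cycleViolation lam d (x k, x (k + 1)) := by
  set τ := periodicArrivals lam s
  set A := arrivalTime τ x k with hA
  have hset : {t : ℝ | t ∈ Set.Ico (departureTime τ x k) (departureTime τ x (k + 1)) ∧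
      d < ageOfInformation τ x a₀ t}
      = Set.Ico (departureTime τ x k) (departureTime τ x (k + 1)) ∩ Set.Ioi (A + d) := by
    ext t
    simp only [Set.mem_ofPred_eq, Set.mem_inter_iff, Set.mem_Ioi]
    refine and_congr_right fun h => ?_
    rw [ageOfInformation_of_mem_Ico hlam hx hs ha h.1 h.2, ← hA, lt_sub_iff_add_lt, add_comm]
  have hae : (Set.Ico (departureTime τ x k) (departureTime τ x (k + 1)) ∩ Set.Ioi (A + d) : Set ℝ)
      =ᵐ[volume] (Set.Ioc (max (departureTime τ x k) (A + d)) (departureTime τ x (k + 1))) := by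
    refine (Ico_ae_eq_Ioc.inter (ae_eq_refl _)).trans ?_
    rw [Set.Ioc_inter_Ioi]
    exact ae_eq_refl _
  rw [violationDuration, hset, measureReal_congr hae, Real.volume_real_Ioc, max_comm]
  have h1 : departureTime τ x k = A + x k := rfl
  have h2 : departureTime τ x (k + 1) = A + occupiedSlots lam (x k) / lam + x (k + 1) := by
    rw [departureTime, arrivalTime_succ hlam hx]
  rw [h1, h2, ← add_max, cycleViolation]
  congr 1
  ring

/-- Additivity of the violation time up to the `k`-th departure. -/
theorem volume_violation_departureTime (hlam : 0 < lam) (hx : ∀ k, 0 < x k) (hs : 0 ≤ s) (k : ℕ) :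
    volume.real {t : ℝ | t ∈ Set.Icc 0 (departureTime (periodicArrivals lam s) x k) ∧
        d < ageOfInformation (periodicArrivals lam s) x a₀ t}
      = volume.real {t : ℝ | t ∈ Set.Icc 0 (departureTime (periodicArrivals lam s) x 0) ∧
        d < ageOfInformation (periodicArrivals lam s) x a₀ t}
        + ∑ j ∈ Finset.range k, violationDuration (periodicArrivals lam s) x a₀ d j := by
  set τ := periodicArrivals lam s
  set B := {t : ℝ | d < ageOfInformation τ x a₀ t}
  -- Half-open intervals make the pieces between departures disjoint.
  have hIco : ∀ T : ℝ, volume.real {t : ℝ | t ∈ Set.Icc 0 T ∧ d < ageOfInformation τ x a₀ t}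
      = volume.real (Set.Ico 0 T ∩ B) := fun T =>
    measureReal_congr (Ico_ae_eq_Icc.symm.inter (ae_eq_refl B))
  simp only [hIco]
  induction k with
  | zero => simp
  | succ k ih =>
    rw [Finset.sum_range_succ, ← add_assoc, ← ih]
    have hD : 0 ≤ departureTime τ x k := (arrivalTime_nonneg hlam hx hs k).trans
      (arrivalTime_lt_departureTime hx τ k).le
    have hDD : departureTime τ x k ≤ departureTime τ x (k + 1) :=
      (strictMono_departureTime hlam hx).monotone k.le_succ
    rw [← measureReal_inter_add_sdiff (s := Set.Ico 0 (departureTime τ x (k + 1)) ∩ B)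
      (t := Set.Ico 0 (departureTime τ x k)) measurableSet_Ico
      (measure_ne_top_of_subset Set.inter_subset_left (by simp))]
    congr 2
    · ext t
      simp only [Set.mem_inter_iff, Set.mem_Ico]
      constructor
      · tauto
      · rintro ⟨h1, h2⟩
        exact ⟨⟨⟨h1.1, h1.2.trans_le hDD⟩, h2⟩, h1⟩
    · ext t
      simp only [Set.mem_sdiff, Set.mem_inter_iff, Set.mem_Ico, Set.mem_ofPred_eq, B]
      constructor
      · rintro ⟨⟨h1, h2⟩, h3⟩
        exact ⟨⟨not_lt.1 fun h => h3 ⟨h1.1, h⟩, h1.2⟩, h2⟩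
      · rintro ⟨h1, h2⟩
        exact ⟨⟨⟨hD.trans h1.1, h1.2⟩, h2⟩, fun h => absurd h.2 (not_lt.2 h1.1)⟩

end Path

theorem measurable_occupiedSlots (lam : ℝ) : Measurable (occupiedSlots lam) :=
  Nat.measurable_ceil.comp (measurable_const_mul lam)

theorem measurable_occupiedSlots_cast (lam : ℝ) :
    Measurable fun y => (occupiedSlots lam y : ℝ) :=
  (measurable_from_top (f := fun n : ℕ => (n : ℝ))).comp (measurable_occupiedSlots lam)

theorem measurable_cycleLength (lam : ℝ) : Measurable (cycleLength lam) :=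
  ((((measurable_occupiedSlots_cast lam).comp measurable_fst).div_const lam).add
    measurable_snd).sub measurable_fst

theorem measurable_cycleViolation (lam d : ℝ) : Measurable (cycleViolation lam d) :=
  measurable_const.max (((((measurable_occupiedSlots_cast lam).comp measurable_fst).div_const
    lam).add measurable_snd).sub (measurable_fst.max measurable_const))

/-! ### Exponential law: memorylessness and mean excess. -/

section Exponential

variable {r : ℝ}

theorem expMeasure_apply (r : ℝ) {s : Set ℝ} (hs : MeasurableSet s) :
    expMeasure r s = ∫⁻ y, s.indicator (exponentialPDF r) y := by
  rw [expMeasure, gammaMeasure, withDensity_apply _ hs, lintegral_indicator hs]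
  rfl

/-- The memoryless property of the exponential distribution. -/
theorem expMeasure_restrict_Ioi (r : ℝ) {a : ℝ} (ha : 0 ≤ a) :
    (expMeasure r).restrict (Set.Ioi a)
      = ENNReal.ofReal (Real.exp (-(r * a))) • (expMeasure r).map (· + a) := by
  ext s hs
  have hm : Measurable fun y : ℝ => y + a := measurable_add_const a
  rw [Measure.restrict_apply hs, Measure.smul_apply, Measure.map_apply hm hs,
    expMeasure_apply r (hs.inter measurableSet_Ioi), expMeasure_apply r (hm hs), smul_eq_mul,
    ← lintegral_const_mul' _ _ ENNReal.ofReal_ne_top, ← lintegral_add_right_eq_self _ a]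
  refine lintegral_congr_ae ?_
  -- At `y = 0` the two sides differ: `a` is not in `Ioi a`, but the density at `0` need not vanish.
  filter_upwards [Measure.ae_ne volume (0 : ℝ)] with y hy
  by_cases hs' : y + a ∈ s
  · rcases lt_or_gt_of_ne hy with h | h
    · rw [Set.indicator_of_notMem, Set.indicator_of_mem (by exact hs'), exponentialPDF_of_neg h,
        mul_zero]
      simp [h.le]
    · rw [Set.indicator_of_mem (show y + a ∈ s ∩ Set.Ioi a from ⟨hs', by simpa using h⟩),
        Set.indicator_of_mem (by exact hs'),
        exponentialPDF_of_nonneg h.le, exponentialPDF_of_nonneg (by positivity),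
        ← ENNReal.ofReal_mul (Real.exp_pos _).le, mul_add, neg_add, Real.exp_add]
      congr 1
      ring
  · rw [Set.indicator_of_notMem fun h => hs' h.1, Set.indicator_of_notMem (by exact hs'), mul_zero]

theorem expMeasure_Ioi (hr : 0 < r) {a : ℝ} (ha : 0 ≤ a) :
    expMeasure r (Set.Ioi a) = ENNReal.ofReal (Real.exp (-(r * a))) := by
  have := isProbabilityMeasure_expMeasure hr
  have h := congrArg (fun m => m Set.univ) (expMeasure_restrict_Ioi r ha)
  simpa [Measure.map_apply (measurable_add_const a)] using h

theorem ae_pos_expMeasure (hr : 0 < r) : ∀ᵐ y ∂(expMeasure r), 0 < y := by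
  have := isProbabilityMeasure_expMeasure hr
  have h : expMeasure r (Set.Ioi 0) = 1 := by simp [expMeasure_Ioi hr le_rfl]
  exact (prob_compl_eq_zero_iff measurableSet_Ioi).2 h

theorem setIntegral_Ioi_expMeasure (r : ℝ) {a : ℝ} (ha : 0 ≤ a) (f : ℝ → ℝ) :
    ∫ y in Set.Ioi a, f y ∂(expMeasure r)
      = Real.exp (-(r * a)) * ∫ y, f (y + a) ∂(expMeasure r) := by
  rw [expMeasure_restrict_Ioi r ha, integral_smul_measure,
    (measurableEmbedding_addRight a).integral_map, ENNReal.toReal_ofReal (Real.exp_pos _).le,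
    smul_eq_mul]

theorem expMeasure_real_Ioi (hr : 0 < r) {a : ℝ} (ha : 0 ≤ a) :
    (expMeasure r).real (Set.Ioi a) = Real.exp (-(r * a)) := by
  rw [measureReal_def, expMeasure_Ioi hr ha, ENNReal.toReal_ofReal (Real.exp_pos _).le]

theorem expMeasure_real_Ioc (hr : 0 < r) {a b : ℝ} (ha : 0 ≤ a) (hab : a ≤ b) :
    (expMeasure r).real (Set.Ioc a b) = Real.exp (-(r * a)) - Real.exp (-(r * b)) := by
  have := isProbabilityMeasure_expMeasure hr
  rw [← expMeasure_real_Ioi hr ha, ← expMeasure_real_Ioi hr (ha.trans hab),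
    ← Set.Ioc_union_Ioi_eq_Ioi hab,
    measureReal_union (Set.Ioc_disjoint_Ioi le_rfl) measurableSet_Ioi]
  ring

/-- Layer-cake formula: the mean is the integral of the tail `e^{-rt}`. -/
theorem lintegral_id_expMeasure (hr : 0 < r) :
    ∫⁻ y, ENNReal.ofReal y ∂(expMeasure r) = ENNReal.ofReal (1 / r) := by
  rw [lintegral_eq_lintegral_meas_lt _ ((ae_pos_expMeasure hr).mono fun _ h => h.le)
    measurable_id'.aemeasurable]
  rw [setLIntegral_congr_fun (g := fun t => ENNReal.ofReal (Real.exp (-r * t))) measurableSet_Ioi]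
  · rw [← ofReal_integral_eq_lintegral_ofReal (exp_neg_integrableOn_Ioi 0 hr)
      (Eventually.of_forall fun _ => (Real.exp_pos _).le),
      integral_exp_mul_Ioi (by linarith) 0]
    congr 1
    simp
  · intro t ht
    dsimp only
    rw [neg_mul, ← expMeasure_Ioi hr (le_of_lt ht)]
    rfl

theorem integrable_id_expMeasure (hr : 0 < r) : Integrable (fun y => y) (expMeasure r) := by
  refine ⟨measurable_id.aestronglyMeasurable, ?_⟩
  rw [hasFiniteIntegral_iff_ofReal ((ae_pos_expMeasure hr).mono fun _ h => h.le),
    lintegral_id_expMeasure hr]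
  exact ENNReal.ofReal_lt_top

theorem integral_id_expMeasure (hr : 0 < r) : ∫ y, y ∂(expMeasure r) = 1 / r := by
  rw [integral_eq_lintegral_of_nonneg_ae ((ae_pos_expMeasure hr).mono fun _ h => h.le)
    measurable_id.aestronglyMeasurable, lintegral_id_expMeasure hr,
    ENNReal.toReal_ofReal (by positivity)]

/-- Given that `a` is exceeded, which has probability `e^{-ra}`, the excess is again exponential
with mean `1/r`. -/
theorem integral_max_sub_expMeasure_of_nonneg (hr : 0 < r) {a : ℝ} (ha : 0 ≤ a) :
    ∫ y, max 0 (y - a) ∂(expMeasure r) = Real.exp (-(r * a)) / r := by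
  have h : (fun y => max 0 (y - a)) = (Set.Ioi a).indicator (fun y => y - a) := by
    ext y
    by_cases hy : a < y
    · rw [Set.indicator_of_mem (by exact hy), max_eq_right (by linarith)]
    · rw [Set.indicator_of_notMem (by exact hy), max_eq_left (by linarith)]
  rw [h, integral_indicator measurableSet_Ioi, setIntegral_Ioi_expMeasure r ha]
  simp [integral_id_expMeasure hr, div_eq_mul_inv]

theorem integral_max_sub_expMeasure_of_nonpos (hr : 0 < r) {a : ℝ} (ha : a ≤ 0) :
    ∫ y, max 0 (y - a) ∂(expMeasure r) = 1 / r - a := by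
  have := isProbabilityMeasure_expMeasure hr
  have h : (fun y => max 0 (y - a)) =ᵐ[expMeasure r] fun y => y - a := by
    filter_upwards [ae_pos_expMeasure hr] with y hy
    exact max_eq_right (by linarith)
  rw [integral_congr_ae h, integral_sub (integrable_id_expMeasure hr) (integrable_const _),
    integral_id_expMeasure hr]
  simp

end Exponential

/-! ### Mean cycle length and mean violation time. -/

section Slots

variable {lam mu : ℝ}

theorem occupiedSlots_add_div (hlam : 0 < lam) {y : ℝ} (hy : 0 ≤ y) (n : ℕ) :
    occupiedSlots lam (y + n / lam) = occupiedSlots lam y + n := by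
  rw [occupiedSlots, occupiedSlots, mul_add, mul_div_cancel₀ _ hlam.ne',
    Nat.ceil_add_natCast (by positivity)]

theorem occupiedSlots_eq (hlam : 0 < lam) {y : ℝ} {n : ℕ} (h1 : n / lam < y)
    (h2 : y ≤ (n + 1) / lam) : occupiedSlots lam y = n + 1 := by
  rw [occupiedSlots, Nat.ceil_eq_iff (by omega)]
  rw [div_lt_iff₀ hlam] at h1
  rw [le_div_iff₀ hlam] at h2
  constructor
  · push_cast
    linarith
  · push_cast
    linarith

theorem integrable_occupiedSlots (hlam : 0 < lam) (hmu : 0 < mu) :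
    Integrable (fun y => (occupiedSlots lam y : ℝ)) (expMeasure mu) := by
  have := isProbabilityMeasure_expMeasure hmu
  refine (((integrable_id_expMeasure hmu).const_mul lam).add (integrable_const 1)).mono'
    (measurable_occupiedSlots_cast lam).aestronglyMeasurable ?_
  filter_upwards [ae_pos_expMeasure hmu] with y hy
  rw [Real.norm_of_nonneg (by positivity)]
  exact (Nat.ceil_lt_add_one (by positivity)).le

theorem one_sub_exp_pos (hlam : 0 < lam) (hmu : 0 < mu) : 0 < 1 - Real.exp (-(mu / lam)) := by
  have : Real.exp (-(mu / lam)) < 1 := Real.exp_lt_one_iff.2 (by simpa using div_pos hmu hlam)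
  linarith

/-- Memorylessness shifts the tail back to the origin, and a shift by `n` whole periods adds exactly
`n` slots. -/
theorem setIntegral_Ioi_occupiedSlots (hlam : 0 < lam) (hmu : 0 < mu) (n : ℕ) :
    ∫ y in Set.Ioi (n / lam), (occupiedSlots lam y : ℝ) ∂(expMeasure mu)
      = Real.exp (-(mu * (n / lam))) * (∫ y, (occupiedSlots lam y : ℝ) ∂(expMeasure mu) + n) := by
  have := isProbabilityMeasure_expMeasure hmu
  rw [setIntegral_Ioi_expMeasure mu (by positivity)]
  congr 1
  have h : (fun y => (occupiedSlots lam (y + n / lam) : ℝ)) =ᵐ[expMeasure mu]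
      fun y => (occupiedSlots lam y : ℝ) + n := by
    filter_upwards [ae_pos_expMeasure hmu] with y hy
    rw [occupiedSlots_add_div hlam hy.le, Nat.cast_add]
  rw [integral_congr_ae h, integral_add (integrable_occupiedSlots hlam hmu) (integrable_const _)]
  simp

theorem setIntegral_expMeasure_Ioc_const {f : ℝ → ℝ} {a b c : ℝ} (hmu : 0 < mu) (ha : 0 ≤ a)
    (hab : a ≤ b) (hf : ∀ y, a < y → y ≤ b → f y = c) :
    ∫ y in Set.Ioc a b, f y ∂(expMeasure mu)
      = (Real.exp (-(mu * a)) - Real.exp (-(mu * b))) * c := by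
  rw [setIntegral_congr_fun measurableSet_Ioc (g := fun _ => c) fun y hy => hf y hy.1 hy.2,
    setIntegral_const, expMeasure_real_Ioc hmu ha hab, smul_eq_mul]

theorem integral_expMeasure_eq_setIntegral_Ioi (hmu : 0 < mu) (f : ℝ → ℝ) :
    ∫ y, f y ∂(expMeasure mu) = ∫ y in Set.Ioi 0, f y ∂(expMeasure mu) := by
  rw [Measure.restrict_eq_self_of_ae_mem]
  exact ae_pos_expMeasure hmu

theorem setIntegral_Ioi_split {m : Measure ℝ} {f : ℝ → ℝ} (hf : Integrable f m) {a b : ℝ}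
    (hab : a ≤ b) :
    ∫ y in Set.Ioi a, f y ∂m = ∫ y in Set.Ioc a b, f y ∂m + ∫ y in Set.Ioi b, f y ∂m := by
  rw [← Set.Ioc_union_Ioi_eq_Ioi hab, setIntegral_union (Set.Ioc_disjoint_Ioi le_rfl)
    measurableSet_Ioi hf.integrableOn hf.integrableOn]

/-- First-step equation `E M = (1 - e^{-μ/λ}) + e^{-μ/λ} (E M + 1)`, solved for the mean number of
slots `E M`. -/
theorem integral_occupiedSlots (hlam : 0 < lam) (hmu : 0 < mu) :
    ∫ y, (occupiedSlots lam y : ℝ) ∂(expMeasure mu) = 1 / (1 - Real.exp (-(mu / lam))) := by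
  have hp := one_sub_exp_pos hlam hmu
  have h := setIntegral_Ioi_split (integrable_occupiedSlots hlam hmu)
    (show (0 : ℝ) ≤ 1 / lam by positivity)
  have h1 := setIntegral_Ioi_occupiedSlots hlam hmu 1
  rw [Nat.cast_one] at h1
  rw [← integral_expMeasure_eq_setIntegral_Ioi hmu, h1,
    setIntegral_expMeasure_Ioc_const (c := 1) hmu le_rfl (by positivity)] at h
  · rw [mul_zero, neg_zero, Real.exp_zero, mul_one_div] at h
    rw [eq_div_iff hp.ne']
    linarith
  · intro y h1 h2
    rw [occupiedSlots_eq (n := 0) hlam (by simpa using h1) (by simpa using h2)]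
    simp

/-- The law of two independent exponential service times. -/
noncomputable def expPair (mu : ℝ) : Measure (ℝ × ℝ) := (expMeasure mu).prod (expMeasure mu)

theorem isProbabilityMeasure_expPair (hmu : 0 < mu) : IsProbabilityMeasure (expPair mu) := by
  have := isProbabilityMeasure_expMeasure hmu
  rw [expPair]
  infer_instance

theorem ae_pos_expPair (hmu : 0 < mu) : ∀ᵐ z ∂(expPair mu), 0 < z.1 ∧ 0 < z.2 := by
  have := isProbabilityMeasure_expMeasure hmu
  rw [expPair]
  exact (Measure.quasiMeasurePreserving_fst.ae (ae_pos_expMeasure hmu)).and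
    (Measure.quasiMeasurePreserving_snd.ae (ae_pos_expMeasure hmu))

theorem integrable_cycleLength (hlam : 0 < lam) (hmu : 0 < mu) :
    Integrable (cycleLength lam) (expPair mu) := by
  have := isProbabilityMeasure_expMeasure hmu
  exact ((((integrable_occupiedSlots hlam hmu).div_const lam).comp_fst _).add
    ((integrable_id_expMeasure hmu).comp_snd _)).sub ((integrable_id_expMeasure hmu).comp_fst _)

/-- The two service times have equal means and cancel, leaving the mean number of slots divided by
`lam`. -/
theorem integral_cycleLength (hlam : 0 < lam) (hmu : 0 < mu) :
    ∫ z, cycleLength lam z ∂(expPair mu) = 1 / (lam * (1 - Real.exp (-(mu / lam)))) := by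
  have := isProbabilityMeasure_expMeasure hmu
  have i1 : Integrable (fun z : ℝ × ℝ => (occupiedSlots lam z.1 : ℝ) / lam) (expPair mu) :=
    ((integrable_occupiedSlots hlam hmu).div_const lam).comp_fst _
  have i2 : Integrable (fun z : ℝ × ℝ => z.2) (expPair mu) :=
    (integrable_id_expMeasure hmu).comp_snd _
  have i3 : Integrable (fun z : ℝ × ℝ => z.1) (expPair mu) :=
    (integrable_id_expMeasure hmu).comp_fst _
  simp only [cycleLength]
  have i12 : Integrable (fun z : ℝ × ℝ => (occupiedSlots lam z.1 : ℝ) / lam + z.2) (expPair mu) :=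
    i1.add i2
  rw [integral_sub i12 i3, integral_add i1 i2]
  have e1 : ∫ z : ℝ × ℝ, (occupiedSlots lam z.1 : ℝ) / lam ∂(expPair mu) = _ :=
    integral_fun_fst fun y : ℝ => (occupiedSlots lam y : ℝ) / lam
  have e2 : ∫ z : ℝ × ℝ, z.2 ∂(expPair mu) = _ := integral_fun_snd fun y : ℝ => y
  have e3 : ∫ z : ℝ × ℝ, z.1 ∂(expPair mu) = _ := integral_fun_fst fun y : ℝ => y
  rw [e1, e2, e3, integral_div, integral_occupiedSlots hlam hmu]
  have hp := (one_sub_exp_pos hlam hmu).ne'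
  simp
  field_simp

/-- This domination gives integrability of the violation time and, later, a violation probability of
at most one. -/
theorem cycleViolation_le_cycleLength (hlam : 0 < lam) (d : ℝ) {z : ℝ × ℝ} (hz : 0 < z.2) :
    cycleViolation lam d z ≤ cycleLength lam z := by
  have h := le_occupiedSlots_div hlam z.1
  rw [cycleViolation, cycleLength]
  exact max_le (by linarith) (by linarith [le_max_left z.1 d])

theorem integrable_cycleViolation (hlam : 0 < lam) (hmu : 0 < mu) (d : ℝ) :
    Integrable (cycleViolation lam d) (expPair mu) := by
  refine (integrable_cycleLength hlam hmu).mono'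
    (measurable_cycleViolation lam d).aestronglyMeasurable ?_
  filter_upwards [ae_pos_expPair hmu] with z hz
  rw [Real.norm_of_nonneg (show 0 ≤ cycleViolation lam d z from le_max_left _ _)]
  exact cycleViolation_le_cycleLength hlam d hz.2

/-- The mean violation time given the first of the two service times. -/
noncomputable def conditionalViolation (lam mu d x : ℝ) : ℝ :=
  ∫ y, cycleViolation lam d (x, y) ∂(expMeasure mu)

/-- Exhibits a mean excess of an exponential variable; the sign of the threshold decides which of
the next two formulas applies. -/
theorem conditionalViolation_eq (lam mu d x : ℝ) : conditionalViolation lam mu d x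
    = ∫ y, max 0 (y - (max x d - occupiedSlots lam x / lam)) ∂(expMeasure mu) := by
  simp only [conditionalViolation, cycleViolation]
  congr 1
  ext y
  congr 1
  ring

theorem conditionalViolation_of_ge (hmu : 0 < mu) {d x : ℝ}
    (h : max x d ≤ occupiedSlots lam x / lam) :
    conditionalViolation lam mu d x = occupiedSlots lam x / lam - max x d + 1 / mu := by
  rw [conditionalViolation_eq, integral_max_sub_expMeasure_of_nonpos hmu (by linarith)]
  ring

theorem conditionalViolation_of_le (hmu : 0 < mu) {d x : ℝ} (hx : x ≤ d)
    (h : occupiedSlots lam x / lam ≤ d) : conditionalViolation lam mu d x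
      = Real.exp (-(mu * (d - occupiedSlots lam x / lam))) / mu := by
  rw [conditionalViolation_eq, max_eq_right hx,
    integral_max_sub_expMeasure_of_nonneg hmu (by linarith)]

theorem integrable_conditionalViolation (hlam : 0 < lam) (hmu : 0 < mu) (d : ℝ) :
    Integrable (conditionalViolation lam mu d) (expMeasure mu) := by
  have := isProbabilityMeasure_expMeasure hmu
  exact (integrable_cycleViolation hlam hmu d).integral_prod_left

/-- On each period `(m/λ, (m+1)/λ]` the integrand is the constant `e^{-μ(d-(m+1)/λ)}/μ`, and its
growth in `m` exactly offsets the decay of the mass of the period. All `n` periods therefore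
contribute equally. -/
theorem setIntegral_conditionalViolation_Ioc (hlam : 0 < lam) (hmu : 0 < mu) {d : ℝ} (n : ℕ)
    (hn : n / lam ≤ d) :
    ∫ x in Set.Ioc 0 (n / lam), conditionalViolation lam mu d x ∂(expMeasure mu)
      = n * (Real.exp (-(mu * d)) / mu * (Real.exp (mu / lam) - 1)) := by
  have := isProbabilityMeasure_expMeasure hmu
  induction n with
  | zero => simp
  | succ n ih =>
    have hle : (n : ℝ) / lam ≤ ((n + 1 : ℕ) : ℝ) / lam := by
      gcongr
      omega
    have hi := integrable_conditionalViolation hlam hmu d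
    rw [← Set.Ioc_union_Ioc_eq_Ioc (show (0 : ℝ) ≤ n / lam by positivity) hle,
      setIntegral_union (Set.Ioc_disjoint_Ioc_of_le le_rfl) measurableSet_Ioc hi.integrableOn
        hi.integrableOn, ih (hle.trans hn),
      setIntegral_expMeasure_Ioc_const (c := Real.exp (-(mu * (d - (n + 1 : ℕ) / lam))) / mu) hmu
        (by positivity) hle]
    · have e1 : Real.exp (-(mu * (n / lam)))
          = Real.exp (-(mu * ((n + 1 : ℕ) / lam))) * Real.exp (mu / lam) := by
        rw [← Real.exp_add]
        congr 1
        push_cast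
        ring
      have e2 : Real.exp (-(mu * (d - (n + 1 : ℕ) / lam)))
          = Real.exp (-(mu * d)) * (Real.exp (-(mu * ((n + 1 : ℕ) / lam))))⁻¹ := by
        rw [← Real.exp_neg, ← Real.exp_add]
        congr 1
        ring
      rw [e1, e2]
      push_cast
      field_simp
    · intro x h1 h2
      have h3 : occupiedSlots lam x = n + 1 := occupiedSlots_eq hlam h1 (by exact_mod_cast h2)
      rw [conditionalViolation_of_le hmu (h2.trans hn) (by rwa [h3]), h3]

theorem setIntegral_conditionalViolation_Ioi (hlam : 0 < lam) (hmu : 0 < mu) {d : ℝ}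
    (hd : 0 ≤ d) :
    ∫ x in Set.Ioi d, conditionalViolation lam mu d x ∂(expMeasure mu)
      = Real.exp (-(mu * (⌈lam * d⌉₊ / lam))) / (lam * (1 - Real.exp (-(mu / lam))))
        + Real.exp (-(mu * d)) * (⌈lam * d⌉₊ / lam - d) := by
  have := isProbabilityMeasure_expMeasure hmu
  set c := ⌈lam * d⌉₊
  have hdc : d ≤ c / lam := le_occupiedSlots_div hlam d
  have h : ∀ x ∈ Set.Ioi d, conditionalViolation lam mu d x
      = (occupiedSlots lam x : ℝ) / lam - x + 1 / mu := fun x hx => by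
    have hx' : max x d = x := max_eq_left (le_of_lt hx)
    rw [conditionalViolation_of_ge hmu (by rw [hx']; exact le_occupiedSlots_div hlam x), hx']
  have iM := integrable_occupiedSlots hlam hmu
  have ix := integrable_id_expMeasure hmu
  have isub : Integrable (fun x => (occupiedSlots lam x : ℝ) / lam - x) (expMeasure mu) :=
    (iM.div_const lam).sub ix
  -- The tail integral of the slot number is cut at the first grid point `c / lam` from `d` on: up
  -- to there it equals `c`, and beyond it the shift formula applies.
  rw [setIntegral_congr_fun measurableSet_Ioi h,
    integral_add isub.integrableOn (integrable_const _).integrableOn,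
    integral_sub (iM.div_const lam).integrableOn ix.integrableOn, integral_div,
    setIntegral_const, expMeasure_real_Ioi hmu hd, setIntegral_Ioi_expMeasure mu hd (fun x => x),
    integral_add ix (integrable_const _), integral_id_expMeasure hmu,
    setIntegral_Ioi_split iM hdc, setIntegral_Ioi_occupiedSlots hlam hmu,
    setIntegral_expMeasure_Ioc_const (c := (c : ℝ)) hmu hd hdc, integral_occupiedSlots hlam hmu]
  · have hp := (one_sub_exp_pos hlam hmu).ne'
    simp only [integral_const, probReal_univ, smul_eq_mul]
    field_simp
    ring
  · intro x h1 h2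
    rw [le_div_iff₀ hlam, mul_comm] at h2
    rw [occupiedSlots, le_antisymm (Nat.ceil_le.2 h2) (Nat.ceil_mono (by gcongr))]

theorem integral_cycleViolation (hlam : 0 < lam) (hmu : 0 < mu) {d : ℝ} (hd : 0 ≤ d) :
    ∫ z, cycleViolation lam d z ∂(expPair mu) = meanDurationDM11 lam mu d := by
  have := isProbabilityMeasure_expMeasure hmu
  have hi := integrable_conditionalViolation hlam hmu d
  have h0 : (⌊lam * d⌋₊ : ℝ) / lam ≤ d := by
    rw [div_le_iff₀ hlam, mul_comm]
    exact Nat.floor_le (by positivity)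
  have hfub : ∫ z, cycleViolation lam d z ∂(expPair mu)
      = ∫ x, conditionalViolation lam mu d x ∂(expMeasure mu) :=
    integral_prod _ (integrable_cycleViolation hlam hmu d)
  have hmid : ∫ x in Set.Ioc ((⌊lam * d⌋₊ : ℝ) / lam) d, conditionalViolation lam mu d x
      ∂(expMeasure mu) = (Real.exp (-(mu * (⌊lam * d⌋₊ / lam))) - Real.exp (-(mu * d)))
        * (⌈lam * d⌉₊ / lam - d + 1 / mu) := by
    refine setIntegral_expMeasure_Ioc_const hmu (by positivity) h0 fun x h1 h2 => ?_
    have h3 : occupiedSlots lam x = ⌈lam * d⌉₊ := by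
      -- Between the last grid point up to `d` and `d` itself: `⌈λd⌉ ≤ ⌊λd⌋ + 1 ≤ ⌈λx⌉`.
      refine le_antisymm (Nat.ceil_mono (by gcongr)) ?_
      refine (Nat.ceil_le_floor_add_one _).trans ?_
      rw [occupiedSlots, Nat.add_one_le_ceil_iff]
      rwa [div_lt_iff₀ hlam, mul_comm x] at h1
    have h4 : d ≤ occupiedSlots lam x / lam := by
      rw [h3]
      exact le_occupiedSlots_div hlam d
    rw [conditionalViolation_of_ge hmu (by rwa [max_eq_right h2]), max_eq_right h2, h3]
  rw [hfub, integral_expMeasure_eq_setIntegral_Ioi hmu,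
    setIntegral_Ioi_split hi (show (0 : ℝ) ≤ ⌊lam * d⌋₊ / lam by positivity),
    setIntegral_Ioi_split hi h0, setIntegral_conditionalViolation_Ioc hlam hmu _ h0, hmid,
    setIntegral_conditionalViolation_Ioi hlam hmu hd, meanDurationDM11,
    ← natCast_floor_eq_intCast_floor (by positivity),
    ← natCast_ceil_eq_intCast_ceil (by positivity)]
  -- The terms `e^{-μd}(⌈λd⌉/λ - d)` of the last two pieces cancel; what remains of them gives the
  -- `-1` in the closed form.
  simp only [neg_mul, neg_div]
  ring

end Slots
open scoped ENNReal

/-! ### Probability of a fresh last departure. -/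

section Fresh

variable {lam mu d : ℝ}

/-- The probability that, `w` units of time after its arrival and at most `d`, a served packet is
the last one that has departed. -/
noncomputable def freshProb (lam mu d w : ℝ) : ℝ≥0∞ :=
  (Set.Icc 0 d).indicator
    (fun w => expPair mu {z | z.1 ≤ w ∧ w < occupiedSlots lam z.1 / lam + z.2}) w

theorem measurableSet_fresh (lam : ℝ) : MeasurableSet
    {p : ℝ × (ℝ × ℝ) | p.2.1 ≤ p.1 ∧ p.1 < occupiedSlots lam p.2.1 / lam + p.2.2} := by
  have h : Measurable fun p : ℝ × (ℝ × ℝ) => (occupiedSlots lam p.2.1 : ℝ) :=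
    (measurable_occupiedSlots_cast lam).comp (measurable_fst.comp measurable_snd)
  exact (measurableSet_le measurable_snd.fst measurable_fst).inter
    (measurableSet_lt measurable_fst ((h.div_const lam).add measurable_snd.snd))

theorem measurable_freshProb (hmu : 0 < mu) : Measurable (freshProb lam mu d) := by
  have := isProbabilityMeasure_expPair hmu
  exact (measurable_measure_prodMk_left (measurableSet_fresh lam)).indicator measurableSet_Icc

theorem freshProb_eq_zero {w : ℝ} (h : w ∉ Set.Icc 0 d) : freshProb lam mu d w = 0 :=
  Set.indicator_of_notMem h _

/-- By Tonelli, integrate over `w` first: for fixed service times the admissible `w` form the part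
of the cycle with age at most `d`, whose length is cycle length minus violation time. -/
theorem lintegral_freshProb (hlam : 0 < lam) (hmu : 0 < mu) (hd : 0 ≤ d) :
    ∫⁻ w, freshProb lam mu d w = ENNReal.ofReal
      (1 / (lam * (1 - Real.exp (-(mu / lam)))) - meanDurationDM11 lam mu d) := by
  have := isProbabilityMeasure_expPair hmu
  have hS := measurableSet_fresh lam
  have hL := integrable_cycleLength hlam hmu
  have hG := integrable_cycleViolation hlam hmu d
  rw [← integral_cycleLength hlam hmu, ← integral_cycleViolation hlam hmu hd,
    ← integral_sub hL hG,
    ofReal_integral_eq_lintegral_ofReal (f := fun z => cycleLength lam z - cycleViolation lam d z)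
      (hL.sub hG)]
  · calc ∫⁻ w, freshProb lam mu d w
        = ((volume.restrict (Set.Icc 0 d)).prod (expPair mu)) _ := by
          rw [Measure.prod_apply hS]
          exact lintegral_indicator measurableSet_Icc _
      _ = _ := by
          rw [Measure.prod_apply_symm hS]
          refine lintegral_congr_ae ?_
          filter_upwards [ae_pos_expPair hmu] with z hz
          set e := (occupiedSlots lam z.1 : ℝ) / lam + z.2 with he
          have hze : z.1 ≤ e := by linarith [le_occupiedSlots_div hlam z.1]
          have hset : ((fun w => (w, z)) ⁻¹' {p : ℝ × (ℝ × ℝ) | p.2.1 ≤ p.1 ∧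
              p.1 < occupiedSlots lam p.2.1 / lam + p.2.2}) = Set.Ico z.1 e := rfl
          rw [hset, Measure.restrict_apply measurableSet_Ico,
            measure_congr (Ico_ae_eq_Ioc.inter Ioc_ae_eq_Icc.symm), Set.Ioc_inter_Ioc,
            Real.volume_Ioc, max_eq_left hz.1.le, cycleLength, cycleViolation, ← he]
          rcases le_total z.1 d with h | h
          · rw [max_eq_right h]
            congr 1
            rcases le_total e d with h' | h'
            · rw [min_eq_left h', max_eq_left (by linarith)]
              ring
            · rw [min_eq_right h', max_eq_right (by linarith)]
              ring
          · rw [max_eq_left h, max_eq_right (by linarith), sub_self, ENNReal.ofReal_zero,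
              ENNReal.ofReal_eq_zero]
            linarith [min_le_right e d]
  · filter_upwards [ae_pos_expPair hmu] with z hz
    exact sub_nonneg.2 (cycleViolation_le_cycleLength hlam d hz.2)

theorem expMeasure_occupiedSlots_eq (hlam : 0 < lam) (hmu : 0 < mu) (n : ℕ) :
    expMeasure mu {y | occupiedSlots lam y = n + 1}
      = ENNReal.ofReal (Real.exp (-(mu / lam))) ^ n
        * ENNReal.ofReal (1 - Real.exp (-(mu / lam))) := by
  have := isProbabilityMeasure_expMeasure hmu
  have hset : {y | occupiedSlots lam y = n + 1} = Set.Ioc ((n : ℝ) / lam) ((n + 1) / lam) := by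
    ext y
    refine ⟨fun h => ?_, fun h => occupiedSlots_eq hlam h.1 h.2⟩
    rw [Set.mem_ofPred_eq, occupiedSlots, Nat.ceil_eq_iff (by omega)] at h
    push_cast at h
    rw [Set.mem_Ioc, div_lt_iff₀ hlam, le_div_iff₀ hlam, mul_comm y]
    exact ⟨by simpa using h.1, h.2⟩
  rw [hset, ← ENNReal.ofReal_toReal (measure_ne_top (expMeasure mu) _), ← measureReal_def,
    expMeasure_real_Ioc hmu (by positivity) (by gcongr; linarith),
    ← ENNReal.ofReal_pow (Real.exp_pos _).le, ← ENNReal.ofReal_mul (by positivity),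
    ← Real.exp_nat_mul]
  congr 1
  rw [mul_sub, ← Real.exp_add, mul_one]
  congr 2 <;> ring

end Fresh

/-! ### Renewal sequence with geometric increments. -/

section Renewal

variable {Ω : Type*} [MeasurableSpace Ω] {P : Measure Ω}

/-- Convolution formula; the index stops below `n` because `M` is almost surely positive. -/
theorem measure_add_eq_nat {N M : Ω → ℕ} (hN : Measurable N) (hM : Measurable M)
    (hNM : IndepFun N M P) (hpos : ∀ᵐ ω ∂P, 0 < M ω) (n : ℕ) :
    P {ω | N ω + M ω = n}
      = ∑ j ∈ Finset.range n, P {ω | N ω = j} * P {ω | M ω = n - j} := by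
  have hset : {ω | N ω + M ω = n} =ᵐ[P]
      ⋃ j ∈ Finset.range n, (N ⁻¹' {j} ∩ M ⁻¹' {n - j} : Set Ω) := by
    filter_upwards [hpos] with ω hω
    refine propext ?_
    change N ω + M ω = n ↔ ω ∈ ⋃ j ∈ Finset.range n, (N ⁻¹' {j} ∩ M ⁻¹' {n - j} : Set Ω)
    simp only [Set.mem_iUnion, Finset.mem_range, Set.mem_inter_iff, Set.mem_preimage,
      Set.mem_singleton_iff, exists_prop]
    constructor
    · intro h
      exact ⟨N ω, by omega, rfl, by omega⟩
    · rintro ⟨j, h1, h2, h3⟩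
      omega
  rw [measure_congr hset, measure_biUnion_finset]
  · refine Finset.sum_congr rfl fun j _ => ?_
    exact hNM.measure_inter_preimage_eq_mul _ _ (measurableSet_singleton _)
      (measurableSet_singleton _)
  · intro i _ j _ hij
    refine Set.disjoint_left.2 fun ω h1 h2 => hij ?_
    exact h1.1.symm.trans h2.1
  · exact fun j _ => (hN (measurableSet_singleton _)).inter (hM (measurableSet_singleton _))

/-- The renewal sequence of geometric increments: every epoch but the first is a renewal with the
same probability `p`. -/
theorem tsum_measure_partialSum_eq_of_geometric [IsProbabilityMeasure P] {M : ℕ → Ω → ℕ}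
    {p q : ℝ≥0∞} (hpq : p + q = 1) (hM : ∀ k, Measurable (M k)) (hind : iIndepFun M P)
    (hlaw : ∀ k n, P {ω | M k ω = n + 1} = q ^ n * p) (hpos : ∀ k, ∀ᵐ ω ∂P, 0 < M k ω) (n : ℕ) :
    ∑' k, P {ω | ∑ j ∈ Finset.range k, M j ω = n} = if n = 0 then 1 else p := by
  have hS : ∀ k, Measurable fun ω => ∑ j ∈ Finset.range k, M j ω := fun k =>
    Finset.measurable_sum _ fun j _ => hM j
  have hrec : ∀ k n, P {ω | ∑ j ∈ Finset.range (k + 1), M j ω = n}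
      = ∑ j ∈ Finset.range n, P {ω | ∑ j ∈ Finset.range k, M j ω = j}
        * P {ω | M k ω = n - j} := by
    intro k n
    simp only [Finset.sum_range_succ]
    refine measure_add_eq_nat (hS k) (hM k) ?_ (hpos k) n
    have h := hind.indepFun_sum_range_succ hM k
    convert h using 1
    ext ω
    simp
  -- Passing from `n` to `n + 1` multiplies each geometric weight of the convolution by `q` and adds
  -- one new term, `j = n`, of weight `p`.
  have hstep : ∀ k n, P {ω | ∑ j ∈ Finset.range (k + 1), M j ω = n + 1}
      = p * P {ω | ∑ j ∈ Finset.range k, M j ω = n}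
        + q * P {ω | ∑ j ∈ Finset.range (k + 1), M j ω = n} := by
    intro k n
    rw [hrec, Finset.sum_range_succ, hrec k n, add_comm, Finset.mul_sum]
    congr 1
    · have h := hlaw k 0
      rw [pow_zero, one_mul, zero_add] at h
      rw [Nat.add_sub_cancel_left, h, mul_comm]
    · refine Finset.sum_congr rfl fun j hj => ?_
      obtain ⟨m, rfl⟩ := Nat.exists_eq_add_of_lt (Finset.mem_range.1 hj)
      rw [show j + m + 1 + 1 - j = m + 1 + 1 by omega, show j + m + 1 - j = m + 1 by omega,
        hlaw, hlaw, pow_succ]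
      ring
  have hU : ∀ n, ∑' k, P {ω | ∑ j ∈ Finset.range k, M j ω = n}
      = P {_ω : Ω | 0 = n} + ∑' k, P {ω | ∑ j ∈ Finset.range (k + 1), M j ω = n} := by
    intro n
    rw [tsum_eq_zero_add' ENNReal.summable]
    simp only [Finset.range_zero, Finset.sum_empty]
  have hU' : ∀ n, ∑' k, P {ω | ∑ j ∈ Finset.range (k + 1), M j ω = n + 1}
      = p * ∑' k, P {ω | ∑ j ∈ Finset.range k, M j ω = n}
        + q * ∑' k, P {ω | ∑ j ∈ Finset.range (k + 1), M j ω = n} := by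
    intro n
    simp only [hstep, ENNReal.tsum_add, ENNReal.tsum_mul_left]
  have h0 : ∑' k, P {ω | ∑ j ∈ Finset.range (k + 1), M j ω = 0} = 0 := by
    simp only [hrec, Finset.range_zero, Finset.sum_empty, tsum_zero]
  have h00 : ∑' k, P {ω | ∑ j ∈ Finset.range k, M j ω = 0} = 1 := by
    rw [hU, h0]
    simp
  -- Summed over `k`, the recursion reads `u (n+1) = p u n + q u n` for `n ≥ 1`, because the empty
  -- sum contributes only at `0`; so `u` stays at `u 1 = p`.
  have key : ∀ n, ∑' k, P {ω | ∑ j ∈ Finset.range (k + 1), M j ω = n + 1} = p := by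
    intro n
    induction n with
    | zero => rw [hU', h0, h00, mul_zero, add_zero, mul_one]
    | succ n ih =>
      rw [hU', hU (n + 1), ih]
      simp only [Nat.zero_ne_add_one, Set.ofPred_false, measure_empty, zero_add]
      rw [← add_mul, hpq, one_mul]
  rcases n with _ | n
  · simpa using h00
  · rw [hU, key]
    simp

end Renewal

/-! ### The probabilistic model and the law of the age at a fixed time. -/

/-- I.i.d. exponential service times, independent of the nonnegative time of the first arrival. -/
structure IsDM11 {Ω : Type*} [MeasurableSpace Ω] (P : Measure Ω) (mu : ℝ) (X : ℕ → Ω → ℝ)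
    (φ : Ω → ℝ) : Prop where
  measurable_service : ∀ k, Measurable (X k)
  map_service : ∀ k, P.map (X k) = expMeasure mu
  iIndepFun_service : iIndepFun X P
  measurable_phase : Measurable φ
  phase_nonneg : ∀ᵐ ω ∂P, 0 ≤ φ ω
  indepFun_phase : IndepFun φ (fun ω k => X k ω) P

namespace IsDM11

variable {Ω : Type*} {lam mu d a₀ : ℝ} {X : ℕ → Ω → ℝ} {φ : Ω → ℝ}

/-- The index of the `k`-th served packet, as a sum of the numbers of periods for which the server
has been occupied. -/
noncomputable def slotSum (lam : ℝ) (X : ℕ → Ω → ℝ) (k : ℕ) (ω : Ω) : ℕ :=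
  ∑ j ∈ Finset.range k, occupiedSlots lam (X j ω)

/-- The event that the `k`-th served packet is the last one that has departed by time `t`, and
arrived at most `d` units of time before. -/
def freshEvent (lam d : ℝ) (X : ℕ → Ω → ℝ) (φ : Ω → ℝ) (t : ℝ) (k : ℕ) : Set Ω :=
  {ω | t - φ ω - slotSum lam X k ω / lam ∈ Set.Icc 0 d ∧
    X k ω ≤ t - φ ω - slotSum lam X k ω / lam ∧
    t - φ ω - slotSum lam X k ω / lam < occupiedSlots lam (X k ω) / lam + X (k + 1) ω}

theorem arrivalTime_eq (hlam : 0 < lam) {ω : Ω} (hω : ∀ k, 0 < X k ω) (k : ℕ) :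
    arrivalTime (periodicArrivals lam (φ ω)) (fun k => X k ω) k
      = φ ω + slotSum lam X k ω / lam := by
  rw [arrivalTime, servedIndex_periodicArrivals hlam hω, periodicArrivals, slotSum]

/-- Membership in `freshEvent` in terms of departures. -/
theorem mem_freshEvent_iff (hlam : 0 < lam) {ω : Ω} (hω : ∀ k, 0 < X k ω) (t : ℝ) (k : ℕ) :
    ω ∈ freshEvent lam d X φ t k ↔
      (departureTime (periodicArrivals lam (φ ω)) (fun k => X k ω) k ≤ t ∧
        t < departureTime (periodicArrivals lam (φ ω)) (fun k => X k ω) (k + 1)) ∧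
        t - arrivalTime (periodicArrivals lam (φ ω)) (fun k => X k ω) k ≤ d := by
  have hM := hω k
  rw [departureTime, departureTime, arrivalTime_succ hlam hω, arrivalTime_eq hlam hω]
  simp only [freshEvent, Set.mem_ofPred_eq, Set.mem_Icc]
  constructor
  · rintro ⟨⟨h1, h2⟩, h3, h4⟩
    exact ⟨⟨by linarith, by linarith⟩, by linarith⟩
  · rintro ⟨⟨h1, h2⟩, h3⟩
    exact ⟨⟨by linarith, by linarith⟩, by linarith, by linarith⟩

variable [MeasurableSpace Ω] {P : Measure Ω}

theorem ae_pos (h : IsDM11 P mu X φ) (hmu : 0 < mu) : ∀ᵐ ω ∂P, ∀ k, 0 < X k ω := by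
  rw [ae_all_iff]
  intro k
  have h1 := ae_pos_expMeasure hmu
  rw [← h.map_service k] at h1
  exact ae_of_ae_map (h.measurable_service k).aemeasurable h1

theorem measurable_pair (h : IsDM11 P mu X φ) (i j : ℕ) :
    Measurable fun ω => (X i ω, X j ω) :=
  (h.measurable_service i).prodMk (h.measurable_service j)

theorem measurable_slotSum (h : IsDM11 P mu X φ) (lam : ℝ) (k : ℕ) :
    Measurable (slotSum lam X k) :=
  Finset.measurable_sum _ fun j _ =>
    (measurable_occupiedSlots lam).comp (h.measurable_service j)

theorem indepFun_phase_slotSum_pair (h : IsDM11 P mu X φ) (lam : ℝ) (k : ℕ) :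
    IndepFun φ (fun ω => (slotSum lam X k ω, (X k ω, X (k + 1) ω))) P := by
  have hg : Measurable fun v : ℕ → ℝ =>
      ((∑ j ∈ Finset.range k, occupiedSlots lam (v j), (v k, v (k + 1))) : ℕ × (ℝ × ℝ)) :=
    (Finset.measurable_sum _ fun j _ =>
      (measurable_occupiedSlots lam).comp (measurable_pi_apply j)).prodMk
      ((measurable_pi_apply _).prodMk (measurable_pi_apply _))
  exact h.indepFun_phase.comp measurable_id hg

theorem indepFun_slotSum_pair (h : IsDM11 P mu X φ) (lam : ℝ) (k : ℕ) :
    IndepFun (slotSum lam X k) (fun ω => (X k ω, X (k + 1) ω)) P := by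
  have hd : Disjoint (Finset.range k) {k, k + 1} := by
    rw [Finset.disjoint_left]
    intro i hi hi'
    simp only [Finset.mem_range, Finset.mem_insert, Finset.mem_singleton] at hi hi'
    omega
  have hi := h.iIndepFun_service.indepFun_finset _ _ hd h.measurable_service
  have hf : Measurable fun v : (Finset.range k) → ℝ => ∑ j, occupiedSlots lam (v j) :=
    Finset.measurable_sum _ fun j _ => (measurable_occupiedSlots lam).comp (measurable_pi_apply j)
  have hg : Measurable fun v : ({k, k + 1} : Finset ℕ) → ℝ =>
      (v ⟨k, by simp⟩, v ⟨k + 1, by simp⟩) :=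
    (measurable_pi_apply _).prodMk (measurable_pi_apply _)
  have h2 := hi.comp hf hg
  refine h2.congr (Eventually.of_forall fun ω => ?_) (ae_eq_refl _)
  exact Finset.sum_coe_sort (Finset.range k) fun j => occupiedSlots lam (X j ω)

theorem measurableSet_fresh_section (lam d t : ℝ) :
    MeasurableSet {p : ℝ × (ℕ × (ℝ × ℝ)) | t - p.1 - p.2.1 / lam ∈ Set.Icc 0 d ∧
      p.2.2.1 ≤ t - p.1 - p.2.1 / lam ∧
      t - p.1 - p.2.1 / lam < occupiedSlots lam p.2.2.1 / lam + p.2.2.2} := by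
  have h1 : Measurable fun p : ℝ × (ℕ × (ℝ × ℝ)) => (p.2.1 : ℝ) :=
    (measurable_from_top (f := fun n : ℕ => (n : ℝ))).comp measurable_snd.fst
  have h2 : Measurable fun p : ℝ × (ℕ × (ℝ × ℝ)) => t - p.1 - p.2.1 / lam :=
    (measurable_const.sub measurable_fst).sub (h1.div_const lam)
  have h3 : Measurable fun p : ℝ × (ℕ × (ℝ × ℝ)) => (p.2.2 : ℝ × ℝ) := measurable_snd.snd
  exact (h2 measurableSet_Icc).inter (measurableSet_fresh lam |> (h2.prodMk h3))

theorem measurableSet_freshEvent (h : IsDM11 P mu X φ) (lam d t : ℝ) (k : ℕ) :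
    MeasurableSet (freshEvent lam d X φ t k) :=
  (h.measurable_phase.prodMk ((h.measurable_slotSum lam k).prodMk
    (h.measurable_pair k (k + 1)))) (measurableSet_fresh_section lam d t)

theorem ae_mem_iUnion_freshEvent_iff (h : IsDM11 P mu X φ) (hlam : 0 < lam) (hmu : 0 < mu)
    (ha : 0 ≤ a₀) {t : ℝ} (ht : d < t) :
    ∀ᵐ ω ∂P, (ageOfInformation (periodicArrivals lam (φ ω)) (fun k => X k ω) a₀ t ≤ d ↔
      ω ∈ ⋃ k, freshEvent lam d X φ t k) := by
  filter_upwards [h.ae_pos hmu, h.phase_nonneg] with ω hω hφ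
  rw [ageOfInformation_le_iff hlam hω hφ ha ht, Set.mem_iUnion]
  exact exists_congr fun k => (mem_freshEvent_iff hlam hω t k).symm

variable [IsProbabilityMeasure P]

theorem map_pair (h : IsDM11 P mu X φ) {i j : ℕ} (hij : i ≠ j) :
    P.map (fun ω => (X i ω, X j ω)) = expPair mu := by
  rw [(indepFun_iff_map_prod_eq_prod_map_map (h.measurable_service i).aemeasurable
    (h.measurable_service j).aemeasurable).1 (h.iIndepFun_service.indepFun hij), h.map_service,
    h.map_service, expPair]

theorem map_phase_slotSum_pair (h : IsDM11 P mu X φ) (lam : ℝ) (k : ℕ) :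
    P.map (fun ω => (φ ω, (slotSum lam X k ω, (X k ω, X (k + 1) ω))))
      = (P.map φ).prod ((P.map (slotSum lam X k)).prod (expPair mu)) := by
  rw [(indepFun_iff_map_prod_eq_prod_map_map h.measurable_phase.aemeasurable
      ((h.measurable_slotSum lam k).prodMk (h.measurable_pair k (k + 1))).aemeasurable).1
      (h.indepFun_phase_slotSum_pair lam k),
    (indepFun_iff_map_prod_eq_prod_map_map (h.measurable_slotSum lam k).aemeasurable
      (h.measurable_pair k (k + 1)).aemeasurable).1 (h.indepFun_slotSum_pair lam k),
    h.map_pair (by omega)]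

theorem tsum_measure_slotSum (h : IsDM11 P mu X φ) (hlam : 0 < lam) (hmu : 0 < mu) (n : ℕ) :
    ∑' k, P {ω | slotSum lam X k ω = n}
      = if n = 0 then 1 else ENNReal.ofReal (1 - Real.exp (-(mu / lam))) := by
  have hM : ∀ k, Measurable fun ω => occupiedSlots lam (X k ω) := fun k =>
    (measurable_occupiedSlots lam).comp (h.measurable_service k)
  refine tsum_measure_partialSum_eq_of_geometric (q := ENNReal.ofReal (Real.exp (-(mu / lam)))) ?_
    hM (h.iIndepFun_service.comp (fun _ => occupiedSlots lam)
      fun _ => measurable_occupiedSlots lam) ?_ ?_ n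
  · rw [← ENNReal.ofReal_add (one_sub_exp_pos hlam hmu).le (Real.exp_pos _).le]
    simp
  · intro k m
    rw [← expMeasure_occupiedSlots_eq hlam hmu, ← h.map_service k]
    exact (Measure.map_apply (h.measurable_service k)
      (measurable_occupiedSlots lam (measurableSet_singleton (m + 1)))).symm
  · intro k
    filter_upwards [h.ae_pos hmu] with ω hω using occupiedSlots_pos hlam (hω k)

/-- The mean, over the phase, of the probability that a packet served `n` periods after the first
arrival, for `t` measured from its nominal arrival time, is a fresh last departure. -/
noncomputable def meanFresh (P : Measure Ω) (φ : Ω → ℝ) (lam mu d t : ℝ) : ℝ≥0∞ :=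
  ∫⁻ ω, freshProb lam mu d (t - φ ω) ∂P

/-- Phase, slot index and the pair of service times are independent, the index depending only on
earlier services. Integrating out the pair gives `freshProb`; the index and the phase are averaged
afterwards. -/
theorem measure_freshEvent (h : IsDM11 P mu X φ) (hmu : 0 < mu) (t : ℝ) (k : ℕ) :
    P (freshEvent lam d X φ t k)
      = ∑' n : ℕ, P {ω | slotSum lam X k ω = n} * meanFresh P φ lam mu d (t - n / lam) := by
  have := isProbabilityMeasure_expPair hmu
  have hm := h.measurable_phase.prodMk ((h.measurable_slotSum lam k).prodMk
    (h.measurable_pair k (k + 1)))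
  have hS := measurableSet_fresh_section lam d t
  have := Measure.isProbabilityMeasure_map (μ := P) (h.measurable_slotSum lam k).aemeasurable
  have hR := measurable_freshProb (lam := lam) (d := d) hmu
  have e1 : P (freshEvent lam d X φ t k)
      = P.map (fun ω => (φ ω, (slotSum lam X k ω, (X k ω, X (k + 1) ω)))) _ :=
    (Measure.map_apply hm hS).symm
  rw [e1, h.map_phase_slotSum_pair, Measure.prod_apply hS]
  have e2 : ∀ s : ℝ, ((P.map (slotSum lam X k)).prod (expPair mu)) (Prod.mk s ⁻¹'
      {p : ℝ × (ℕ × (ℝ × ℝ)) | t - p.1 - p.2.1 / lam ∈ Set.Icc 0 d ∧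
      p.2.2.1 ≤ t - p.1 - p.2.1 / lam ∧
      t - p.1 - p.2.1 / lam < occupiedSlots lam p.2.2.1 / lam + p.2.2.2})
      = ∑' n : ℕ, P {ω | slotSum lam X k ω = n} * freshProb lam mu d (t - n / lam - s) := by
    intro s
    rw [Measure.prod_apply (measurable_prodMk_left hS), lintegral_countable']
    refine tsum_congr fun n => ?_
    rw [mul_comm, Measure.map_apply (h.measurable_slotSum lam k) (measurableSet_singleton n)]
    congr 1
    rw [show t - n / lam - s = t - s - n / lam by ring, freshProb]
    by_cases hw : t - s - n / lam ∈ Set.Icc 0 d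
    · rw [Set.indicator_of_mem hw]
      congr 1
      ext z
      exact and_iff_right hw
    · rw [Set.indicator_of_notMem hw]
      convert measure_empty (μ := expPair mu)
      ext z
      exact iff_of_false (fun hz => hw hz.1) id
  simp only [e2]
  have hmeas : ∀ n : ℕ, Measurable fun s => freshProb lam mu d (t - n / lam - s) := fun n =>
    hR.comp (measurable_const.sub measurable_id)
  rw [lintegral_tsum fun n => ((hmeas n).const_mul _).aemeasurable]
  refine tsum_congr fun n => ?_
  rw [lintegral_const_mul _ (hmeas n), lintegral_map (hmeas n) h.measurable_phase, meanFresh]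

/-- The events are almost surely disjoint, since `t` lies in at most one interval between
departures. After exchanging the sums, `k` enters only through the renewal mass at slot `n`. -/
theorem measure_iUnion_freshEvent (h : IsDM11 P mu X φ) (hlam : 0 < lam) (hmu : 0 < mu) (t : ℝ) :
    P (⋃ k, freshEvent lam d X φ t k)
      = ∑' n : ℕ, (if n = 0 then 1 else ENNReal.ofReal (1 - Real.exp (-(mu / lam))))
        * meanFresh P φ lam mu d (t - n / lam) := by
  rw [measure_iUnion₀]
  · simp only [h.measure_freshEvent hmu]
    rw [ENNReal.tsum_comm]
    refine tsum_congr fun n => ?_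
    rw [ENNReal.tsum_mul_right, h.tsum_measure_slotSum hlam hmu]
  · have key : ∀ i j, i < j → AEDisjoint P (freshEvent lam d X φ t i)
        (freshEvent lam d X φ t j) := by
      intro i j hij
      refine measure_mono_null (t := {ω | ¬ ∀ k, 0 < X k ω}) ?_ (h.ae_pos hmu)
      rintro ω ⟨h1, h2⟩ hω
      rw [mem_freshEvent_iff hlam hω] at h1 h2
      have := (strictMono_departureTime (s := φ ω) hlam hω).monotone (show i + 1 ≤ j from hij)
      linarith [h1.1.2, h2.1.1]
    intro i j hij
    rcases lt_or_gt_of_ne hij with h' | h'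
    · exact key i j h'
    · exact (key j i h').symm
  · exact fun k => (h.measurableSet_freshEvent lam d t k).nullMeasurableSet

theorem measureReal_violation (h : IsDM11 P mu X φ) (hlam : 0 < lam) (hmu : 0 < mu)
    (ha : 0 ≤ a₀) {t : ℝ} (ht : d < t) :
    P.real {ω | d < ageOfInformation (periodicArrivals lam (φ ω)) (fun k => X k ω) a₀ t}
      = 1 - P.real (⋃ k, freshEvent lam d X φ t k) := by
  rw [← probReal_compl_eq_one_sub
    (MeasurableSet.iUnion fun k => h.measurableSet_freshEvent lam d t k)]
  refine measureReal_congr ?_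
  filter_upwards [h.ae_mem_iUnion_freshEvent_iff hlam hmu ha ht] with ω hω
  exact propext (not_le.symm.trans (not_congr hω))

end IsDM11

/-! ### Averaging over a period, and the limit of the violation probability. -/

theorem tsum_setLIntegral_Ico_translate {c : ℝ} (hc : 0 < c) (F : ℝ → ℝ≥0∞) :
    ∑' m : ℕ, ∫⁻ y in Set.Ico 0 c, F (y + m * c) = ∫⁻ y in Set.Ici 0, F y := by
  have hU : (Set.Ici 0 : Set ℝ) = ⋃ m : ℕ, Set.Ico (m * c) ((m + 1) * c) := by
    ext y
    simp only [Set.mem_Ici, Set.mem_iUnion, Set.mem_Ico]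
    constructor
    · intro hy
      refine ⟨⌊y / c⌋₊, ?_, ?_⟩
      · rw [← le_div_iff₀ hc]
        exact Nat.floor_le (by positivity)
      · rw [← div_lt_iff₀ hc]
        exact Nat.lt_floor_add_one _
    · rintro ⟨m, hm, -⟩
      exact le_trans (by positivity) hm
  have hdisj : Pairwise (Function.onFun Disjoint
      fun m : ℕ => Set.Ico ((m : ℝ) * c) ((m + 1) * c)) := by
    have key : ∀ i j : ℕ, i < j →
        Disjoint (Set.Ico ((i : ℝ) * c) ((i + 1) * c)) (Set.Ico ((j : ℝ) * c) ((j + 1) * c)) := by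
      intro i j hij
      refine Set.disjoint_left.2 fun y h1 h2 => ?_
      have : ((i : ℝ) + 1) * c ≤ j * c := by
        gcongr
        exact_mod_cast hij
      linarith [h1.2, h2.1]
    intro i j hij
    rcases lt_or_gt_of_ne hij with h | h
    · exact key i j h
    · exact (key j i h).symm
  rw [hU, lintegral_iUnion (fun m => measurableSet_Ico) hdisj]
  refine tsum_congr fun m => ?_
  rw [← lintegral_indicator measurableSet_Ico, ← lintegral_indicator measurableSet_Ico,
    ← lintegral_add_right_eq_self ((Set.Ico ((m : ℝ) * c) ((m + 1) * c)).indicator F) (m * c)]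
  refine lintegral_congr fun y => ?_
  have hiff : y ∈ Set.Ico 0 c ↔ y + m * c ∈ Set.Ico (m * c) ((m + 1) * c) := by
    rw [Set.mem_Ico, Set.mem_Ico]
    constructor <;> rintro ⟨h1, h2⟩ <;> constructor <;> linarith
  by_cases hy : y ∈ Set.Ico 0 c
  · rw [Set.indicator_of_mem hy, Set.indicator_of_mem (hiff.1 hy)]
  · rw [Set.indicator_of_notMem hy, Set.indicator_of_notMem (mt hiff.2 hy)]

theorem nuDM11_eq (lam mu : ℝ) : nuDM11 lam mu = lam * (1 - Real.exp (-(mu / lam))) := by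
  rw [nuDM11, neg_div]

theorem nuDM11_pos {lam mu : ℝ} (hlam : 0 < lam) (hmu : 0 < mu) : 0 < nuDM11 lam mu := by
  rw [nuDM11_eq]
  exact mul_pos hlam (one_sub_exp_pos hlam hmu)

/-- Ensures that `ENNReal.ofReal` does not truncate the complementary probability. -/
theorem nuDM11_mul_meanDurationDM11_le_one {lam mu d : ℝ} (hlam : 0 < lam) (hmu : 0 < mu)
    (hd : 0 ≤ d) : nuDM11 lam mu * meanDurationDM11 lam mu d ≤ 1 := by
  have h := integral_mono_ae (integrable_cycleViolation hlam hmu d)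
    (integrable_cycleLength hlam hmu)
    ((ae_pos_expPair hmu).mono fun z hz => cycleViolation_le_cycleLength hlam d hz.2)
  rw [integral_cycleViolation hlam hmu hd, integral_cycleLength hlam hmu, ← nuDM11_eq,
    le_div_iff₀ (nuDM11_pos hlam hmu)] at h
  linarith

theorem mul_lintegral_freshProb {lam mu d : ℝ} (hlam : 0 < lam) (hmu : 0 < mu) (hd : 0 ≤ d) :
    ENNReal.ofReal (1 - Real.exp (-(mu / lam)))
        * (ENNReal.ofReal lam * ∫⁻ w, freshProb lam mu d w)
      = ENNReal.ofReal (1 - nuDM11 lam mu * meanDurationDM11 lam mu d) := by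
  have hp := one_sub_exp_pos hlam hmu
  rw [lintegral_freshProb hlam hmu hd, ← ENNReal.ofReal_mul hlam.le, ← ENNReal.ofReal_mul hp.le,
    nuDM11_eq]
  congr 1
  field_simp

namespace IsDM11

variable {Ω : Type*} [MeasurableSpace Ω] {P : Measure Ω} {lam mu d a₀ : ℝ} {X : ℕ → Ω → ℝ}
  {φ : Ω → ℝ}

theorem meanFresh_of_neg (h : IsDM11 P mu X φ) {t : ℝ} (ht : t < 0) :
    meanFresh P φ lam mu d t = 0 := by
  have h0 : (fun ω => freshProb lam mu d (t - φ ω)) =ᵐ[P] 0 := by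
    filter_upwards [h.phase_nonneg] with ω hω
    exact freshProb_eq_zero fun hm => by linarith [hm.1]
  rw [meanFresh, lintegral_congr_ae h0]
  simp

theorem lintegral_comp_of_isUniform (h : IsDM11 P mu X φ) (hlam : 0 < lam)
    (hu : pdf.IsUniform φ (Set.Ico 0 (1 / lam)) P volume) {f : ℝ → ℝ≥0∞} (hf : Measurable f) :
    ∫⁻ ω, f (φ ω) ∂P = ENNReal.ofReal lam * ∫⁻ y in Set.Ico 0 (1 / lam), f y := by
  rw [← lintegral_map hf h.measurable_phase, hu, ProbabilityTheory.cond, lintegral_smul_measure,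
    Real.volume_Ico, sub_zero, smul_eq_mul, ← ENNReal.ofReal_inv_of_pos (by positivity),
    one_div, inv_inv]

variable [IsProbabilityMeasure P]

theorem measurable_meanFresh (h : IsDM11 P mu X φ) (hmu : 0 < mu) :
    Measurable (meanFresh P φ lam mu d) := by
  have hR := measurable_freshProb (lam := lam) (d := d) hmu
  refine Measurable.lintegral_prod_right (f := fun t ω => freshProb lam mu d (t - φ ω)) ?_
  exact hR.comp (measurable_fst.sub (h.measurable_phase.comp measurable_snd))

/-- Tonelli and translation invariance: averaging over the phase does not change the total integral.
-/
theorem lintegral_meanFresh (h : IsDM11 P mu X φ) (hmu : 0 < mu) :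
    ∫⁻ t in Set.Ici 0, meanFresh P φ lam mu d t = ∫⁻ w, freshProb lam mu d w := by
  have hR := measurable_freshProb (lam := lam) (d := d) hmu
  have h1 : ∫⁻ t in Set.Ici 0, meanFresh P φ lam mu d t = ∫⁻ t, meanFresh P φ lam mu d t := by
    refine setLIntegral_eq_of_support_subset fun t ht => ?_
    by_contra h0
    exact ht (h.meanFresh_of_neg (not_le.1 h0))
  rw [h1]
  simp only [meanFresh]
  rw [lintegral_lintegral_swap (f := fun t ω => freshProb lam mu d (t - φ ω))
    (hR.comp (measurable_fst.sub (h.measurable_phase.comp measurable_snd))).aemeasurable]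
  simp only [lintegral_sub_right_eq_self]
  simp

theorem measure_iUnion_freshEvent_add (h : IsDM11 P mu X φ) (hlam : 0 < lam) (hmu : 0 < mu)
    {s : ℝ} (hs : s < 1 / lam) (j : ℕ) :
    P (⋃ k, freshEvent lam d X φ (s + j / lam) k)
      = meanFresh P φ lam mu d (s + j / lam) + ENNReal.ofReal (1 - Real.exp (-(mu / lam)))
        * ∑ m ∈ Finset.range j, meanFresh P φ lam mu d (s + m / lam) := by
  -- Slots `n > j` see a negative time and vanish. The slot `n = 0` has weight one and is separated;
  -- the others are reindexed by `m = j - n`.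
  rw [h.measure_iUnion_freshEvent hlam hmu, tsum_eq_sum (s := Finset.range (j + 1)),
    Finset.sum_range_succ', add_comm, Finset.mul_sum, ← Finset.sum_range_reflect]
  · congr 1
    · simp
    · refine Finset.sum_congr rfl fun m hm => ?_
      rw [if_neg (by omega)]
      congr 2
      have hm := Finset.mem_range.1 hm
      have : ((j - 1 - m + 1 : ℕ) : ℝ) = j - m := by
        rw [show j - 1 - m + 1 = j - m by omega, Nat.cast_sub hm.le]
      rw [this]
      ring
  · intro n hn
    have hn : ((j : ℝ) + 1) / lam ≤ n / lam := by
      gcongr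
      exact_mod_cast not_lt.1 (mt Finset.mem_range.2 hn)
    rw [h.meanFresh_of_neg (by rw [add_div] at hn; linarith), mul_zero]

theorem eq_of_tendsto_violation (h : IsDM11 P mu X φ) (hlam : 0 < lam) (hmu : 0 < mu)
    (hd : 0 ≤ d) (ha : 0 ≤ a₀) {v : ℝ}
    (hv : Tendsto (fun t : ℝ => P.real {ω | d < ageOfInformation (periodicArrivals lam (φ ω))
      (fun k => X k ω) a₀ t}) atTop (𝓝 v)) :
    v = nuDM11 lam mu * meanDurationDM11 lam mu d := by
  set p := ENNReal.ofReal (1 - Real.exp (-(mu / lam))) with hp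
  have hp0 : p ≠ 0 := (ENNReal.ofReal_pos.2 (one_sub_exp_pos hlam hmu)).ne'
  have hA : Tendsto (fun t : ℝ => P (⋃ k, freshEvent lam d X φ t k)) atTop
      (𝓝 (ENNReal.ofReal (1 - v))) := by
    refine (ENNReal.tendsto_ofReal (hv.const_sub 1)).congr' ?_
    filter_upwards [eventually_gt_atTop d] with t ht
    rw [h.measureReal_violation hlam hmu ha ht, sub_sub_cancel, ofReal_measureReal]
  have hv1 : v ≤ 1 := le_of_tendsto' hv fun t => measureReal_le_one
  have key : ∀ s ∈ Set.Ico 0 (1 / lam),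
      p * ∑' m : ℕ, meanFresh P φ lam mu d (s + m * (1 / lam)) = ENNReal.ofReal (1 - v) := by
    intro s hs
    simp only [mul_one_div]
    have hsum := ENNReal.tendsto_nat_tsum fun m : ℕ => meanFresh P φ lam mu d (s + m / lam)
    have hmul := ENNReal.Tendsto.const_mul (a := p) hsum (Or.inr ENNReal.ofReal_ne_top)
    have hle : p * ∑' m : ℕ, meanFresh P φ lam mu d (s + m / lam) ≤ 1 := by
      refine le_of_tendsto' hmul fun j => ?_
      refine le_trans ?_ (prob_le_one (μ := P) (s := ⋃ k, freshEvent lam d X φ (s + j / lam) k))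
      rw [h.measure_iUnion_freshEvent_add hlam hmu hs.2]
      exact le_add_self
    -- Partial sums are bounded by probabilities, so the series is finite and its terms tend to
    -- zero. The exceptional first-slot term thus disappears in the limit.
    have hfin : ∑' m : ℕ, meanFresh P φ lam mu d (s + m / lam) ≠ ⊤ := by
      intro htop
      rw [htop, ENNReal.mul_top hp0] at hle
      simp at hle
    have h0 := ENNReal.tendsto_atTop_zero_of_tsum_ne_top hfin
    have hlim := h0.add hmul
    rw [zero_add] at hlim
    refine tendsto_nhds_unique hlim ?_
    have hsj : Tendsto (fun j : ℕ => s + (j : ℝ) / lam) atTop atTop :=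
      tendsto_atTop_add_const_left _ _ (tendsto_natCast_atTop_atTop.atTop_div_const hlam)
    refine (hA.comp hsj).congr fun j => ?_
    exact h.measure_iUnion_freshEvent_add hlam hmu hs.2 j
  have hb := h.measurable_meanFresh (lam := lam) (d := d) hmu
  -- The series is constant in `s`; integrating over one period glues the translates into the
  -- integral over the half-line.
  have hint := setLIntegral_congr_fun (μ := volume) measurableSet_Ico key
  have hmeas : ∀ m : ℕ, Measurable fun s => meanFresh P φ lam mu d (s + m * (1 / lam)) :=
    fun m => hb.comp (measurable_add_const _)
  rw [lintegral_const_mul _ (Measurable.tsum hmeas),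
    lintegral_tsum fun m => (hmeas m).aemeasurable,
    tsum_setLIntegral_Ico_translate (by positivity), h.lintegral_meanFresh hmu,
    setLIntegral_const, Real.volume_Ico, sub_zero] at hint
  have hfinal := mul_lintegral_freshProb hlam hmu hd
  rw [← hp, mul_left_comm, hint, mul_comm (ENNReal.ofReal (1 - v)), ← mul_assoc,
    ← ENNReal.ofReal_mul hlam.le, mul_one_div_cancel hlam.ne', ENNReal.ofReal_one, one_mul,
    ENNReal.ofReal_eq_ofReal_iff (by linarith)
      (by linarith [nuDM11_mul_meanDurationDM11_le_one hlam hmu hd])] at hfinal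
  linarith

/-- With a uniform phase, each slot contributes `lam` times the integral of `freshProb` over a
window of one period, and the windows tile. The probability is thus exactly constant once `t > d + 1
/ lam`. -/
theorem tendsto_violation_of_isUniform (h : IsDM11 P mu X φ) (hlam : 0 < lam) (hmu : 0 < mu)
    (hd : 0 ≤ d) (ha : 0 ≤ a₀) (hu : pdf.IsUniform φ (Set.Ico 0 (1 / lam)) P volume) :
    Tendsto (fun t : ℝ => P.real {ω | d < ageOfInformation (periodicArrivals lam (φ ω))
      (fun k => X k ω) a₀ t}) atTop (𝓝 (nuDM11 lam mu * meanDurationDM11 lam mu d)) := by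
  have hR := measurable_freshProb (lam := lam) (d := d) hmu
  refine tendsto_const_nhds.congr' ?_
  filter_upwards [eventually_gt_atTop (d + 1 / lam)] with t ht
  have hl : 0 < 1 / lam := by positivity
  have hb : ∀ u, meanFresh P φ lam mu d u
      = ENNReal.ofReal lam * ∫⁻ y in Set.Ico 0 (1 / lam), freshProb lam mu d (u - y) := fun u =>
    h.lintegral_comp_of_isUniform hlam hu (hR.comp (measurable_const.sub measurable_id))
  -- The first arrival is by now more than `d` old, so its weight `1` may be replaced by the common
  -- weight.
  have h0 : meanFresh P φ lam mu d t = 0 := by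
    rw [hb, setLIntegral_congr_fun (g := fun _ => 0) measurableSet_Ico]
    · simp
    · exact fun y hy => freshProb_eq_zero fun hm => by linarith [hm.2, hy.2]
  have hsum : P (⋃ k, freshEvent lam d X φ t k)
      = ENNReal.ofReal (1 - nuDM11 lam mu * meanDurationDM11 lam mu d) := by
    have hc : ∀ n : ℕ, (if n = 0 then 1 else ENNReal.ofReal (1 - Real.exp (-(mu / lam))))
        * meanFresh P φ lam mu d (t - n / lam) = ENNReal.ofReal (1 - Real.exp (-(mu / lam)))
        * (ENNReal.ofReal lam
          * ∫⁻ y in Set.Ico 0 (1 / lam), freshProb lam mu d (t - (y + n * (1 / lam)))) := by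
      intro n
      have hn : meanFresh P φ lam mu d (t - n / lam) = ENNReal.ofReal lam
          * ∫⁻ y in Set.Ico 0 (1 / lam), freshProb lam mu d (t - (y + n * (1 / lam))) := by
        rw [hb]
        simp only [mul_one_div, sub_sub, add_comm]
      rw [← hn]
      rcases n with _ | n
      · simp [h0]
      · simp
    have hI : ∫⁻ y in Set.Ici 0, freshProb lam mu d (t - y) = ∫⁻ w, freshProb lam mu d w := by
      rw [← lintegral_sub_left_eq_self (freshProb lam mu d) t]
      refine setLIntegral_eq_of_support_subset fun y hy => ?_
      by_contra hy0
      exact hy (freshProb_eq_zero fun hm => by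
        rw [Set.mem_Ici, not_le] at hy0
        linarith [hm.2])
    rw [h.measure_iUnion_freshEvent hlam hmu]
    simp only [hc]
    rw [ENNReal.tsum_mul_left, ENNReal.tsum_mul_left,
      tsum_setLIntegral_Ico_translate hl fun y => freshProb lam mu d (t - y), hI,
      mul_lintegral_freshProb hlam hmu hd]
  rw [h.measureReal_violation hlam hmu ha (by linarith), measureReal_def, hsum,
    ENNReal.toReal_ofReal
      (by linarith [nuDM11_mul_meanDurationDM11_le_one hlam hmu hd]), sub_sub_cancel]

end IsDM11

/-! ### Long-run time averages. -/

/-- A monotone function grows linearly at the rate at which it does along a sequence that itself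
grows linearly. -/
theorem tendsto_div_atTop_of_monotone {V : ℝ → ℝ} (hV : Monotone V) (hV0 : ∀ T, 0 ≤ V T)
    {t : ℕ → ℝ} (ht : Monotone t) (htop : Tendsto t atTop atTop) {b c : ℝ} (hc : 0 < c)
    (htc : Tendsto (fun n : ℕ => t n / n) atTop (𝓝 c))
    (hVb : Tendsto (fun n : ℕ => V (t n) / n) atTop (𝓝 b)) :
    Tendsto (fun T => V T / T) atTop (𝓝 (b / c)) := by
  have hex : ∀ T, ∃ k, t 0 ≤ T → t k ≤ T ∧ T < t (k + 1) := fun T => by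
    by_cases h : t 0 ≤ T
    · obtain ⟨k, hk⟩ := exists_mem_Ico_of_tendsto htop h
      exact ⟨k, fun _ => hk⟩
    · exact ⟨0, fun h' => absurd h' h⟩
  choose k hk using hex
  have hktop : Tendsto k atTop atTop := by
    refine tendsto_atTop.2 fun K => ?_
    filter_upwards [eventually_ge_atTop (t K)] with T hT
    have h1 := (hk T ((ht K.zero_le).trans hT)).2
    by_contra hlt
    exact absurd (hT.trans_lt h1) (not_lt.2 (ht (by omega)))
  have hratio : Tendsto (fun n : ℕ => (n : ℝ) / (n + 1 : ℝ)) atTop (𝓝 1) :=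
    tendsto_natCast_div_add_atTop 1
  have hratio' : Tendsto (fun n : ℕ => ((n : ℝ) + 1) / n) atTop (𝓝 1) := by
    simpa using hratio.inv₀ one_ne_zero
  have hsucc := tendsto_add_atTop_nat 1
  -- For `t n ≤ T < t (n + 1)` with `t n > 0`, monotonicity puts `V T / T` between `V (t n) / t (n +
  -- 1)` and `V (t (n + 1)) / t n`.
  have hlow : Tendsto (fun n : ℕ => V (t n) / t (n + 1)) atTop (𝓝 (b / c)) := by
    have h := (hVb.div (htc.comp hsucc) hc.ne').mul hratio
    rw [mul_one] at h
    refine h.congr' ?_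
    filter_upwards [eventually_gt_atTop 0] with n hn
    have hn : (n : ℝ) ≠ 0 := by positivity
    have hn1 : (n : ℝ) + 1 ≠ 0 := by positivity
    simp only [Pi.div_apply, Function.comp_apply]
    push_cast
    field_simp
  have hupp : Tendsto (fun n : ℕ => V (t (n + 1)) / t n) atTop (𝓝 (b / c)) := by
    have h := ((hVb.comp hsucc).div htc hc.ne').mul hratio'
    rw [mul_one] at h
    refine h.congr' ?_
    filter_upwards [eventually_gt_atTop 0] with n hn
    have hn : (n : ℝ) ≠ 0 := by positivity
    have hn1 : (n : ℝ) + 1 ≠ 0 := by positivity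
    simp only [Pi.div_apply, Function.comp_apply]
    push_cast
    field_simp
  refine tendsto_of_tendsto_of_tendsto_of_le_of_le' (hlow.comp hktop) (hupp.comp hktop) ?_ ?_
  · filter_upwards [eventually_ge_atTop (t 0), eventually_gt_atTop 0] with T hT hT0
    obtain ⟨h1, h2⟩ := hk T hT
    exact div_le_div₀ (hV0 T) (hV h1) hT0 h2.le
  · filter_upwards [eventually_ge_atTop (t 0),
      (htop.comp hktop).eventually_gt_atTop 0] with T hT hT0
    obtain ⟨h1, h2⟩ := hk T hT
    exact div_le_div₀ (hV0 _) (hV h2.le) hT0 h1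

namespace IsDM11

variable {Ω : Type*} [MeasurableSpace Ω] {P : Measure Ω} [IsProbabilityMeasure P]
  {lam mu d a₀ : ℝ} {X : ℕ → Ω → ℝ} {φ : Ω → ℝ}

theorem integrable_comp_pair (h : IsDM11 P mu X φ) {F : ℝ × ℝ → ℝ}
    (hF : Integrable F (expPair mu)) {i j : ℕ} (hij : i ≠ j) :
    Integrable (fun ω => F (X i ω, X j ω)) P := by
  rw [← h.map_pair hij] at hF
  exact hF.comp_measurable (h.measurable_pair i j)

theorem integral_comp_pair (h : IsDM11 P mu X φ) {F : ℝ × ℝ → ℝ} (hF : Measurable F) {i j : ℕ}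
    (hij : i ≠ j) : ∫ ω, F (X i ω, X j ω) ∂P = ∫ z, F z ∂(expPair mu) := by
  rw [← h.map_pair hij, integral_map (h.measurable_pair i j).aemeasurable hF.aestronglyMeasurable]

/-- Overlapping pairs are dependent, but pairs starting at indices of one parity are disjoint, hence
i.i.d., and the strong law applies. -/
theorem ae_tendsto_sum_even_div (h : IsDM11 P mu X φ) {F : ℝ × ℝ → ℝ} (hFm : Measurable F)
    (hF : Integrable F (expPair mu)) (r : ℕ) :
    ∀ᵐ ω ∂P, Tendsto (fun n : ℕ =>
      (∑ i ∈ Finset.range n, F (X (2 * i + r) ω, X (2 * i + r + 1) ω)) / n) atTop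
      (𝓝 (∫ z, F z ∂(expPair mu))) := by
  have hlaw := strong_law_ae_real (μ := P)
    (fun i ω => F (X (2 * i + r) ω, X (2 * i + r + 1) ω))
    (h.integrable_comp_pair hF (by omega)) ?_ ?_
  · rwa [h.integral_comp_pair hFm (by omega)] at hlaw
  · intro i j hij
    exact (h.iIndepFun_service.indepFun_prodMk_prodMk h.measurable_service _ _ _ _ (by omega)
      (by omega) (by omega) (by omega)).comp hFm hFm
  · intro i
    have hid : IdentDistrib (fun ω => (X (2 * i + r) ω, X (2 * i + r + 1) ω))
        (fun ω => (X (2 * 0 + r) ω, X (2 * 0 + r + 1) ω)) P P :=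
      ⟨(h.measurable_pair _ _).aemeasurable, (h.measurable_pair _ _).aemeasurable, by
        rw [h.map_pair (by omega), h.map_pair (by omega)]⟩
    exact hid.comp hFm

/-- The strong law of large numbers for functions of two consecutive service times. -/
theorem ae_tendsto_sum_div (h : IsDM11 P mu X φ) {F : ℝ × ℝ → ℝ} (hFm : Measurable F)
    (hF : Integrable F (expPair mu)) :
    ∀ᵐ ω ∂P, Tendsto (fun n : ℕ =>
      (∑ i ∈ Finset.range (2 * n), F (X i ω, X (i + 1) ω)) / n) atTop
      (𝓝 (2 * ∫ z, F z ∂(expPair mu))) := by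
  filter_upwards [h.ae_tendsto_sum_even_div hFm hF 0, h.ae_tendsto_sum_even_div hFm hF 1]
    with ω h0 h1
  -- There are `2 * n` terms but the divisor is `n`, hence twice the mean.
  rw [two_mul]
  refine (h0.add h1).congr fun n => ?_
  rw [← add_div]
  congr 1
  induction n with
  | zero => simp
  | succ n ih =>
    rw [mul_add_one, Finset.sum_range_succ _ (2 * n + 1), Finset.sum_range_succ _ (2 * n), ← ih,
      Finset.sum_range_succ, Finset.sum_range_succ]
    simp only [add_zero]
    ring

theorem ae_tendsto_violation_fraction (h : IsDM11 P mu X φ) (hlam : 0 < lam) (hmu : 0 < mu)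
    (hd : 0 ≤ d) (ha : 0 ≤ a₀) :
    ∀ᵐ ω ∂P, Tendsto (fun T : ℝ => volume.real {t : ℝ | t ∈ Set.Icc 0 T ∧
      d < ageOfInformation (periodicArrivals lam (φ ω)) (fun k => X k ω) a₀ t} / T) atTop
      (𝓝 (nuDM11 lam mu * meanDurationDM11 lam mu d)) := by
  filter_upwards [h.ae_pos hmu, h.phase_nonneg,
    h.ae_tendsto_sum_div (measurable_cycleLength lam) (integrable_cycleLength hlam hmu),
    h.ae_tendsto_sum_div (measurable_cycleViolation lam d)
      (integrable_cycleViolation hlam hmu d)] with ω hω hφ hL hG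
  rw [integral_cycleLength hlam hmu, ← nuDM11_eq] at hL
  rw [integral_cycleViolation hlam hmu hd] at hG
  have hnu := nuDM11_pos hlam hmu
  set D := departureTime (periodicArrivals lam (φ ω)) (fun k => X k ω)
  have htwo : StrictMono fun n : ℕ => 2 * n := fun a b hab => by
    dsimp only
    omega
  have hlim : nuDM11 lam mu * meanDurationDM11 lam mu d
      = 2 * meanDurationDM11 lam mu d / (2 * (1 / nuDM11 lam mu)) := by
    field_simp
  rw [hlim]
  have hconst : ∀ C : ℝ, Tendsto (fun n : ℕ => C / (n : ℝ)) atTop (𝓝 0) :=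
    tendsto_const_div_atTop_nhds_zero_nat
  -- Sampling at even departures matches the strong law for `2 * n` terms; the factors two cancel,
  -- and the time before the first departure contributes a constant, negligible after division by
  -- `n`.
  refine tendsto_div_atTop_of_monotone (t := fun n => D (2 * n)) ?_ (fun T => measureReal_nonneg)
    ((strictMono_departureTime hlam hω).comp htwo).monotone
    ((tendsto_departureTime hlam hω).comp htwo.tendsto_atTop) (by positivity) ?_ ?_
  · intro T T' hTT
    have hsub : {t : ℝ | t ∈ Set.Icc 0 T' ∧ d < ageOfInformation (periodicArrivals lam (φ ω))
        (fun k => X k ω) a₀ t} ⊆ Set.Icc 0 T' := fun t ht => ht.1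
    exact measureReal_mono (fun t ht => ⟨⟨ht.1.1, ht.1.2.trans hTT⟩, ht.2⟩)
      (measure_ne_top_of_subset hsub measure_Icc_lt_top.ne)
  · have hsum := (hconst (D 0)).add hL
    rw [zero_add] at hsum
    refine hsum.congr fun n => ?_
    rw [← add_div]
    congr 1
    have htel := Finset.sum_range_sub D (2 * n)
    rw [Finset.sum_congr rfl fun i _ => departureTime_succ_sub hlam hω i] at htel
    linarith
  · have hsum := (hconst (volume.real {t : ℝ | t ∈ Set.Icc 0 (D 0) ∧
      d < ageOfInformation (periodicArrivals lam (φ ω)) (fun k => X k ω) a₀ t})).add hG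
    rw [zero_add] at hsum
    refine hsum.congr fun n => ?_
    rw [← add_div]
    congr 1
    have hadd := volume_violation_departureTime (a₀ := a₀) (d := d) hlam hω hφ (2 * n)
    rw [Finset.sum_congr rfl fun i _ => violationDuration_eq hlam hω hφ ha i] at hadd
    exact hadd.symm

end IsDM11

theorem mainTheorem6 {Ω : Type*} [MeasurableSpace Ω] (P : Measure Ω) [IsProbabilityMeasure P]
    (lam mu d a₀ : ℝ) (hlam : 0 < lam) (hmu : 0 < mu) (hd : 1 / lam ≤ d) (ha₀ : 0 ≤ a₀)
    -- service times: i.i.d. exponential with mean `1 / mu`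
    (X : ℕ → Ω → ℝ) (hX : ∀ k, Measurable (X k)) (hXlaw : ∀ k, P.map (X k) = expMeasure mu)
    (hXindep : iIndepFun X P)
    -- time of the first arrival (constant or random), independent of the service times
    (φ : Ω → ℝ) (hφ : Measurable φ) (hφ0 : ∀ᵐ ω ∂P, 0 ≤ φ ω)
    (hφX : IndepFun φ (fun ω k => X k ω) P) :
    let τ : Ω → ℕ → ℝ := fun ω => periodicArrivals lam (φ ω)
    let x : Ω → ℕ → ℝ := fun ω k => X k ω
    let Δ : ℝ → Ω → ℝ := fun t ω => ageOfInformation (τ ω) (x ω) a₀ t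
    let interDep : ℕ → Ω → ℝ :=
      fun k ω => departureTime (τ ω) (x ω) (k + 1) - departureTime (τ ω) (x ω) k
    let g : ℕ → Ω → ℝ := fun k ω => violationDuration (τ ω) (x ω) a₀ d k
    -- the departure rate
    (∀ k, Integrable (interDep k) P ∧ 1 / (∫ ω, interDep k ω ∂P) = nuDM11 lam mu) ∧
    -- the mean violation time between consecutive peaks
    (∀ k, Integrable (g k) P ∧ ∫ ω, g k ω ∂P = meanDurationDM11 lam mu d) ∧
    -- the long-run fraction of time with age above `d`, almost surely
    (∀ᵐ ω ∂P, Tendsto (fun T : ℝ => volume.real {t : ℝ | t ∈ Set.Icc 0 T ∧ d < Δ t ω} / T) atTop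
      (𝓝 (nuDM11 lam mu * meanDurationDM11 lam mu d))) ∧
    -- the limit of `P(Δ(t) > d)`, whenever it exists
    (∀ v : ℝ, Tendsto (fun t : ℝ => P.real {ω | d < Δ t ω}) atTop (𝓝 v) →
      v = nuDM11 lam mu * meanDurationDM11 lam mu d) ∧
    -- it does exist if the phase of the arrivals is stationary, i.e. uniform over a period
    (pdf.IsUniform φ (Set.Ico 0 (1 / lam)) P volume →
      Tendsto (fun t : ℝ => P.real {ω | d < Δ t ω}) atTop
        (𝓝 (nuDM11 lam mu * meanDurationDM11 lam mu d))) := by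
  intro τ x Δ interDep g
  have h : IsDM11 P mu X φ := ⟨hX, hXlaw, hXindep, hφ, hφ0, hφX⟩
  have hd0 : 0 ≤ d := le_trans (by positivity) hd
  have hne : ∀ k : ℕ, k ≠ k + 1 := fun k => k.succ_ne_self.symm
  have hinter : ∀ k, interDep k =ᵐ[P] fun ω => cycleLength lam (X k ω, X (k + 1) ω) := fun k => by
    filter_upwards [h.ae_pos hmu] with ω hω using departureTime_succ_sub hlam hω k
  have hg : ∀ k, g k =ᵐ[P] fun ω => cycleViolation lam d (X k ω, X (k + 1) ω) := fun k => by
    filter_upwards [h.ae_pos hmu, hφ0] with ω hω hs using violationDuration_eq hlam hω hs ha₀ k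
  refine ⟨fun k => ⟨?_, ?_⟩, fun k => ⟨?_, ?_⟩, ?_, ?_, ?_⟩
  · exact (h.integrable_comp_pair (integrable_cycleLength hlam hmu) (hne k)).congr (hinter k).symm
  · rw [integral_congr_ae (hinter k), h.integral_comp_pair (measurable_cycleLength lam) (hne k),
      integral_cycleLength hlam hmu, one_div_one_div, nuDM11_eq]
  · exact (h.integrable_comp_pair (integrable_cycleViolation hlam hmu d) (hne k)).congr
      (hg k).symm
  · rw [integral_congr_ae (hg k), h.integral_comp_pair (measurable_cycleViolation lam d) (hne k),
      integral_cycleViolation hlam hmu hd0]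
  · exact h.ae_tendsto_violation_fraction hlam hmu hd0 ha₀
  · exact fun v hv => h.eq_of_tendsto_violation hlam hmu hd0 ha₀ hv
  · exact fun hu => h.tendsto_violation_of_isUniform hlam hmu hd0 ha₀ hu
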